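/- Let $I=(a,b)$ be a bounded open interval, $a<b$. For an interval $J$ of positive length $|J|$ let $\langle f\rangle_J=\frac1{|J|}\int_J f$. Let ${\rm VMO}(I)$ be the set of functions $\varphi\colon I\to\mathbb R$ with $\varphi\in L^2(I)$ such that $\langle\varphi^2\rangle_J-\langle\varphi\rangle_J^2\to0$ as $|J|\to0$, uniformly over the intervals $J\subset I$. For $\varphi\in{\rm VMO}(I)$ let $\xi_\varphi(0)=0$ and $$\xi_\varphi(t)=\sup\Big\{\big(\langle\varphi^2\rangle_J-\langle\varphi\rangle_J^2\big)^{1/2}\colon J\subset I \text{ an interval},\ 0<|J|\le t\Big\},\qquad 0<t\le|I|.$$ The decreasing rearrangement of $\varphi$ is the function $\varphi^*$ on $I$ given by $$\varphi^*(t)=\inf\{\lambda\in\mathbb R\colon |\{s\in I\colon \varphi(s)>\lambda\}|\le t-a\},\qquad t\in I.$$ For $T>0$ and $f\colon[0,T]\to[0,\infty)$ let ${\rm conv}_T f$ be the (pointwise) largest function $g\colon[0,T]\to[0,\infty)$ such that $g\le f$ on $[0,T]$ and $s\mapsto s^2g(s)^2$ is convex on $[0,T]$; such a largest function always exists. Theorem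 1.4. If $\varphi\in{\rm VMO}(I)$, then $\varphi^*\in{\rm VMO}(I)$ and $\xi_{\varphi^*}(t)\le({\rm conv}_{|I|}\,\xi_\varphi)(t)$ for all $t\in[0,|I|]$. (In particular $\xi_{\varphi^*}\le\xi_\varphi$ on $[0,|I|]$.) -/

import Mathlib

open MeasureTheory Set

noncomputable section

/-- The squared quadratic oscillation `⟨φ²⟩_J - ⟨φ⟩_J²` of `φ` over the interval `J = (c, d)`. -/
def oscSq (φ : ℝ → ℝ) (c d : ℝ) : ℝ :=
  (⨍ x in Ioo c d, (φ x) ^ 2) - (⨍ x in Ioo c d, φ x) ^ 2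

/-- `φ ∈ VMO(I)` for the interval `I = (a, b)`: `φ` is square integrable on `I`, and
`⟨φ²⟩_J - ⟨φ⟩_J²` tends to `0` as `|J| → 0`, uniformly over the subintervals `J` of `I`. -/
def IsVMO (a b : ℝ) (φ : ℝ → ℝ) : Prop :=
  MemLp φ 2 (volume.restrict (Ioo a b)) ∧
    ∀ ε > 0, ∃ δ > 0, ∀ c d : ℝ, a ≤ c → c < d → d ≤ b → d - c ≤ δ → oscSq φ c d ≤ ε

/-- The modulus `ξ_φ` of a function `φ` on `I = (a, b)`: `ξ_φ(0) = 0`, and for `0 < t ≤ |I|`,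
`ξ_φ(t)` is the supremum of `(⟨φ²⟩_J - ⟨φ⟩_J²)^{1/2}` over the intervals `J ⊆ I` with
`0 < |J| ≤ t`. For `φ ∈ VMO(I)` these numbers are bounded. -/
def vmoModulus (a b : ℝ) (φ : ℝ → ℝ) (t : ℝ) : ℝ :=
  if 0 < t then
    sSup {r : ℝ | ∃ c d : ℝ, a ≤ c ∧ c < d ∧ d ≤ b ∧ d - c ≤ t ∧ r = Real.sqrt (oscSq φ c d)}
  else 0

/-- The decreasing rearrangement on `I = (a, b)`:
`f*(t) = inf {λ : |{s ∈ I : f s > λ}| ≤ t - a}` for `t ∈ I`. -/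
def decRearrangement (a b : ℝ) (f : ℝ → ℝ) (t : ℝ) : ℝ :=
  sInf {l : ℝ | volume {s ∈ Ioo a b | l < f s} ≤ ENNReal.ofReal (t - a)}

/-- The functions `g : [0, T] → [0, ∞)` with `g ≤ f` on `[0, T]` such that
`s ↦ s² g(s)²` is convex on `[0, T]`. -/
def convMinorants (T : ℝ) (f : ℝ → ℝ) : Set (ℝ → ℝ) :=
  {g | (∀ s ∈ Icc 0 T, 0 ≤ g s) ∧ (∀ s ∈ Icc 0 T, g s ≤ f s) ∧
    ConvexOn ℝ (Icc 0 T) (fun s => s ^ 2 * (g s) ^ 2)}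

/-- `conv_T f`, the largest element of `convMinorants T f`, as a pointwise supremum
on `[0, T]`; `convEnvelope_mem` and `le_convEnvelope` show that it is the largest element. -/
def convEnvelope (T : ℝ) (f : ℝ → ℝ) (s : ℝ) : ℝ :=
  sSup ((fun g : ℝ → ℝ => g s) '' convMinorants T f)

theorem le_convEnvelope {T : ℝ} {f g : ℝ → ℝ} (hg : g ∈ convMinorants T f) {s : ℝ}
    (hs : s ∈ Icc 0 T) : g s ≤ convEnvelope T f s := by
  refine le_csSup ⟨f s, ?_⟩ ⟨g, hg, rfl⟩
  rintro _ ⟨h, hh, rfl⟩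
  exact hh.2.1 s hs

theorem convEnvelope_mem {T : ℝ} {f : ℝ → ℝ} (hf : ∀ s ∈ Icc 0 T, 0 ≤ f s) :
    convEnvelope T f ∈ convMinorants T f := by
  have h0 : (fun _ => 0 : ℝ → ℝ) ∈ convMinorants T f := by
    refine ⟨fun _ _ => le_rfl, hf, ?_⟩
    simpa using convexOn_const (0 : ℝ) (convex_Icc (0 : ℝ) T)
  have hne : ∀ s, ((fun g : ℝ → ℝ => g s) '' convMinorants T f).Nonempty :=
    fun s => ⟨_, _, h0, rfl⟩
  have hnn : ∀ s ∈ Icc 0 T, 0 ≤ convEnvelope T f s := fun s hs => le_convEnvelope h0 hs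
  refine ⟨hnn, fun s hs => ?_, convex_Icc 0 T, ?_⟩
  · refine csSup_le (hne s) ?_
    rintro _ ⟨h, hh, rfl⟩
    exact hh.2.1 s hs
  · intro x hx y hy p q hp hq hpq
    have hz : p • x + q • y ∈ Icc 0 T := convex_Icc 0 T hx hy hp hq hpq
    generalize hzd : p • x + q • y = z at hz
    have hR : 0 ≤ p • (x ^ 2 * convEnvelope T f x ^ 2) + q • (y ^ 2 * convEnvelope T f y ^ 2) := by
      simp only [smul_eq_mul]; positivity
    rcases hz.1.eq_or_lt with h | hzpos
    · simpa [← h] using hR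
    have key : convEnvelope T f z ≤ Real.sqrt
        (p • (x ^ 2 * convEnvelope T f x ^ 2) + q • (y ^ 2 * convEnvelope T f y ^ 2)) / z := by
      refine csSup_le (hne z) ?_
      rintro _ ⟨g, hg, rfl⟩
      rw [le_div_iff₀ hzpos]
      refine Real.le_sqrt_of_sq_le ?_
      have h1 := hg.2.2.2 hx hy hp hq hpq
      simp only [hzd] at h1
      have hgx := pow_le_pow_left₀ (hg.1 x hx) (le_convEnvelope hg hx) 2
      have hgy := pow_le_pow_left₀ (hg.1 y hy) (le_convEnvelope hg hy) 2
      calc (g z * z) ^ 2 = z ^ 2 * g z ^ 2 := by ring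
        _ ≤ _ := h1
        _ ≤ _ := by simp only [smul_eq_mul]; gcongr
    have h2 := (le_div_iff₀ hzpos).1 key
    have h3 := pow_le_pow_left₀ (mul_nonneg (hnn z hz) hz.1) h2 2
    rw [Real.sq_sqrt hR] at h3
    calc z ^ 2 * convEnvelope T f z ^ 2 = (convEnvelope T f z * z) ^ 2 := by ring
      _ ≤ _ := h3

end

theorem exists_component_of_isOpen {U : Set ℝ} {a b x : ℝ} (hU : IsOpen U) (hsub : U ⊆ Ioo a b)
    (hx : x ∈ U) : ∃ u v, u < x ∧ x < v ∧ Ioo u v ⊆ U ∧ u ∉ U ∧ v ∉ U := by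
  have hcl : IsClosed Uᶜ := hU.isClosed_compl
  have hxab := hsub hx
  have hL : (Uᶜ ∩ Iic x).Nonempty := ⟨a, fun h => lt_irrefl _ (hsub h).1, hxab.1.le⟩
  have hR : (Uᶜ ∩ Ici x).Nonempty := ⟨b, fun h => lt_irrefl _ (hsub h).2, hxab.2.le⟩
  have hLb : BddAbove (Uᶜ ∩ Iic x) := ⟨x, fun _ h => h.2⟩
  have hRb : BddBelow (Uᶜ ∩ Ici x) := ⟨x, fun _ h => h.2⟩
  have hLm := (hcl.inter isClosed_Iic).csSup_mem hL hLb
  have hRm := (hcl.inter isClosed_Ici).csInf_mem hR hRb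
  refine ⟨sSup (Uᶜ ∩ Iic x), sInf (Uᶜ ∩ Ici x), ?_, ?_, ?_, hLm.1, hRm.1⟩
  · exact lt_of_le_of_ne hLm.2 fun h => hLm.1 (by rw [h]; exact hx)
  · exact lt_of_le_of_ne hRm.2 fun h => hRm.1 (by rw [← h]; exact hx)
  · intro z hz
    by_contra hzU
    rcases le_total z x with h | h
    · exact absurd (le_csSup hLb ⟨hzU, h⟩) (not_le.2 hz.1)
    · exact absurd (csInf_le hRb ⟨hzU, h⟩) (not_le.2 hz.2)

/-- An integral over a bounded open set is nonpositive when it is so over each component. -/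
theorem setIntegral_nonpos_of_components {U : Set ℝ} {a b : ℝ} {f : ℝ → ℝ} (hU : IsOpen U)
    (hsub : U ⊆ Ioo a b) (hf : IntegrableOn f U)
    (h : ∀ u v, u < v → Ioo u v ⊆ U → u ∉ U → v ∉ U → ∫ x in Ioo u v, f x ≤ 0) :
    ∫ x in U, f x ≤ 0 := by
  let S : Set (ℝ × ℝ) := {p | p.1 < p.2 ∧ Ioo p.1 p.2 ⊆ U ∧ p.1 ∉ U ∧ p.2 ∉ U}
  have hdis : S.PairwiseDisjoint (fun p => Ioo p.1 p.2) := by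
    rintro ⟨u, v⟩ ⟨_, hs, hu, hv⟩ ⟨u', v'⟩ ⟨_, hs', hu', hv'⟩ hne
    refine Set.disjoint_left.2 fun x hx hx' => hne ?_
    simp only at *
    have h1 : u = u' := by
      rcases lt_trichotomy u u' with h | h | h
      · exact absurd (hs ⟨h, hx'.1.trans hx.2⟩) hu'
      · exact h
      · exact absurd (hs' ⟨h, hx.1.trans hx'.2⟩) hu
    have h2 : v = v' := by
      rcases lt_trichotomy v v' with h | h | h
      · exact absurd (hs' ⟨hx'.1.trans hx.2, h⟩) hv
      · exact h
      · exact absurd (hs ⟨hx.1.trans hx'.2, h⟩) hv'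
    rw [h1, h2]
  have hcount : S.Countable := hdis.countable_of_isOpen (fun _ _ => isOpen_Ioo)
    (fun p hp => nonempty_Ioo.2 hp.1)
  have hunion : U = ⋃ p : S, Ioo p.1.1 p.1.2 := by
    ext x
    simp only [mem_iUnion]
    constructor
    · intro hx
      obtain ⟨u, v, h1, h2, h3, h4, h5⟩ := exists_component_of_isOpen hU hsub hx
      exact ⟨⟨(u, v), h1.trans h2, h3, h4, h5⟩, h1, h2⟩
    · rintro ⟨p, hp⟩
      exact p.2.2.1 hp
  have := hcount.to_subtype
  have hd : Pairwise (Function.onFun Disjoint (fun p : S => Ioo p.1.1 p.1.2)) :=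
    fun p q hpq => hdis p.2 q.2 (fun h => hpq (Subtype.ext h))
  rw [hunion] at hf ⊢
  rw [integral_iUnion (fun _ => measurableSet_Ioo) hd hf]
  exact tsum_nonpos fun p => h _ _ p.2.1 p.2.2.1 p.2.2.2.1 p.2.2.2.2

/-- If a primitive of `y` is antitone on a set `Z`, then `y ≤ 0` almost everywhere on `Z`. -/
theorem ae_nonpos_of_antitoneOn_primitive {y : ℝ → ℝ} (hy : Integrable y) {c : ℝ} {Z : Set ℝ}
    (hZ : AntitoneOn (fun x => ∫ t in c..x, y t) Z) : ∀ᵐ x, x ∈ Z → y x ≤ 0 := by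
  have hc : ∀ᵐ x : ℝ, x ∉ {x ∈ Z | nhdsWithin x (Z ∩ Ioi x) = ⊥} :=
    (countable_setOfPred_isolated_right_within (s := Z)).ae_notMem _
  filter_upwards [LocallyIntegrable.ae_hasDerivAt_integral hy.locallyIntegrable, hc] with x hx hxc hxZ
  have hne : (nhdsWithin x (Z ∩ Ioi x)).NeBot := ⟨fun h => hxc ⟨hxZ, h⟩⟩
  have hd := ((hx c).hasDerivWithinAt (s := Z ∩ Ioi x))
  rw [hasDerivWithinAt_iff_tendsto_slope' (fun h => lt_irrefl x h.2)] at hd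
  refine le_of_tendsto hd ?_
  filter_upwards [self_mem_nhdsWithin] with z hz
  rw [slope_def_field]
  exact div_nonpos_of_nonpos_of_nonneg (sub_nonpos.2 (hZ hxZ hz.1 (le_of_lt hz.2)))
    (sub_nonneg.2 (le_of_lt hz.2))

theorem exists_shorter_chord {F : ℝ → ℝ} (hF : Continuous F) {u v s : ℝ} (hs : 0 < s)
    (huv : F u = F v) (hlen : s < v - u) (hpos : ∀ x ∈ Ioo u v, F u < F x) :
    ∃ p q, u ≤ p ∧ q ≤ v ∧ s ≤ q - p ∧ q - p < v - u ∧ F p = F q := by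
  set e := (v - u - s) / 2 with he
  have he0 : 0 < e := by rw [he]; linarith
  have h1 := hpos (u + e) ⟨by linarith, by linarith⟩
  have h2 := hpos (v - e) ⟨by linarith, by linarith⟩
  set l := min (F (u + e)) (F (v - e)) with hl
  have hl0 : F u < l := lt_min h1 h2
  obtain ⟨p, hp, hpl⟩ := intermediate_value_Icc (by linarith : u ≤ u + e) hF.continuousOn
    ⟨hl0.le, min_le_left _ _⟩
  obtain ⟨q, hq, hql⟩ := intermediate_value_Icc' (by linarith : v - e ≤ v) hF.continuousOn
    ⟨huv ▸ hl0.le, min_le_right _ _⟩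
  have hpu : u < p := lt_of_le_of_ne hp.1 fun h => by rw [← h] at hpl; linarith
  exact ⟨p, q, hp.1, hq.2, by linarith [hp.2, hq.1], by linarith [hq.2], hpl.trans hql.symm⟩

/-- Among the chords of length at least `s` there is a shortest one; all the excursions of the
function inside it have length at most `s`. -/
theorem exists_minimal_chord {F : ℝ → ℝ} (hF : Continuous F) {a b s : ℝ} (hs : 0 < s)
    (h : ∃ p q, a ≤ p ∧ q ≤ b ∧ s ≤ q - p ∧ F p = F q) :
    ∃ p q, a ≤ p ∧ q ≤ b ∧ s ≤ q - p ∧ F p = F q ∧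
      ∀ u v, p ≤ u → u < v → v ≤ q → F u = F p → F v = F p →
        (∀ x ∈ Ioo u v, F x ≠ F p) → v - u ≤ s := by
  let K : Set (ℝ × ℝ) := {z | a ≤ z.1 ∧ z.2 ≤ b ∧ s ≤ z.2 - z.1 ∧ F z.1 = F z.2}
  have hK : IsCompact K := by
    have hcl : IsClosed K :=
      (isClosed_le continuous_const continuous_fst).inter
        ((isClosed_le continuous_snd continuous_const).inter
          ((isClosed_le continuous_const (continuous_snd.sub continuous_fst)).inter
            (isClosed_eq (hF.comp continuous_fst) (hF.comp continuous_snd))))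
    refine (isCompact_Icc (a := (a, a)) (b := (b, b))).of_isClosed_subset hcl ?_
    rintro ⟨p, q⟩ ⟨h1, h2, h3, -⟩
    simp only at h1 h2 h3
    exact ⟨⟨h1, by simp only; linarith⟩, ⟨by simp only; linarith, h2⟩⟩
  have hne : K.Nonempty := by
    obtain ⟨p, q, h⟩ := h
    exact ⟨(p, q), h⟩
  obtain ⟨⟨p, q⟩, ⟨h1, h2, h3, h4⟩, hmin⟩ :=
    hK.exists_isMinOn hne (continuous_snd.sub continuous_fst).continuousOn
  simp only at h1 h2 h3 h4
  refine ⟨p, q, h1, h2, h3, h4, fun u v hu huv hv hFu hFv hne => ?_⟩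
  by_contra! hlt
  have key : ∀ p' q', u ≤ p' → q' ≤ v → s ≤ q' - p' → q' - p' < v - u → F p' ≠ F q' := by
    intro p' q' hp' hq' hsl hl hFe
    have := hmin (show (p', q') ∈ K from
      ⟨by simp only; linarith, by simp only; linarith, hsl, hFe⟩)
    simp only [Pi.sub_apply, mem_ofPred_eq] at this
    linarith
  have hsign : (∀ x ∈ Ioo u v, F u < F x) ∨ (∀ x ∈ Ioo u v, F x < F u) := by
    by_contra! hcon
    obtain ⟨⟨x, hx, hx1⟩, ⟨z, hz, hz1⟩⟩ := hcon
    obtain ⟨w, hw, hwe⟩ := isPreconnected_Ioo.intermediate_value hx hz hF.continuousOn ⟨hx1, hz1⟩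
    exact hne w hw (hwe.trans hFu)
  rcases hsign with hp | hp
  · obtain ⟨p', q', e1, e2, e3, e4, e5⟩ :=
      exists_shorter_chord hF hs (hFu.trans hFv.symm) hlt hp
    exact key p' q' e1 e2 e3 e4 e5
  · obtain ⟨p', q', e1, e2, e3, e4, e5⟩ :=
      exists_shorter_chord hF.neg hs (by simp [hFu, hFv]) hlt (fun x hx => neg_lt_neg (hp x hx))
    exact key p' q' e1 e2 e3 e4 (neg_injective e5)

theorem integral_Ioo_eq_sub {y : ℝ → ℝ} (hy : Integrable y) (c : ℝ) {u v : ℝ} (huv : u ≤ v) :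
    ∫ x in Ioo u v, y x = (∫ x in c..v, y x) - ∫ x in c..u, y x := by
  rw [intervalIntegral.integral_interval_sub_left hy.intervalIntegrable hy.intervalIntegrable,
    intervalIntegral.integral_of_le huv, integral_Ioc_eq_integral_Ioo]

theorem Integrable.sq_of_mem_Icc {y : ℝ → ℝ} (hy : Integrable y) {P Q : ℝ}
    (hbd : ∀ x, y x ∈ Icc (-Q) P) : Integrable (fun x => y x ^ 2) := by
  have := hy.bdd_mul (c := max P Q) hy.aestronglyMeasurable
    (Filter.Eventually.of_forall fun x => abs_le.2
      ⟨by linarith [(hbd x).1, le_max_right P Q], (hbd x).2.trans (le_max_left _ _)⟩)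
  simpa [pow_two] using this

/-- Summation of the oscillation bound over the components of an open set. -/
theorem setIntegral_sq_le_of_components {a b s κ : ℝ} {y : ℝ → ℝ} (hy : Integrable y)
    (hy2 : Integrable (fun x => y x ^ 2))
    (hchord : ∀ u v, a ≤ u → u < v → v ≤ b → v - u ≤ s → ∫ x in Ioo u v, y x = 0 →
      ∫ x in Ioo u v, y x ^ 2 ≤ κ * (v - u))
    {U : Set ℝ} (hU : IsOpen U) (hsub : U ⊆ Ioo a b)
    (hcomp : ∀ u v, u < v → Ioo u v ⊆ U → u ∉ U → v ∉ U →
      v - u ≤ s ∧ ∫ x in Ioo u v, y x = 0) :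
    ∫ x in U, y x = 0 ∧ ∫ x in U, y x ^ 2 ≤ κ * volume.real U := by
  have hfin : volume U ≠ ⊤ := ((measure_mono hsub).trans_lt measure_Ioo_lt_top).ne
  refine ⟨le_antisymm ?_ ?_, ?_⟩
  · exact setIntegral_nonpos_of_components hU hsub hy.integrableOn
      fun u v h1 h2 h3 h4 => (hcomp u v h1 h2 h3 h4).2.le
  · have := setIntegral_nonpos_of_components (f := fun x => - y x) hU hsub hy.neg.integrableOn
      fun u v h1 h2 h3 h4 => by rw [integral_neg, (hcomp u v h1 h2 h3 h4).2, neg_zero]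
    rw [integral_neg] at this
    linarith
  · have hc : ∀ V : Set ℝ, volume V ≠ ⊤ → ∫ x in V, (y x ^ 2 - κ) =
        (∫ x in V, y x ^ 2) - κ * volume.real V := fun V hV => by
      rw [integral_sub hy2.integrableOn (integrableOn_const hV)]
      simp [mul_comm]
    have := setIntegral_nonpos_of_components (f := fun x => y x ^ 2 - κ) hU hsub
      (hy2.integrableOn.sub (integrableOn_const hfin)) fun u v h1 h2 h3 h4 => by
        rw [hc _ measure_Ioo_lt_top.ne, Real.volume_real_Ioo_of_le h1.le]
        have h5 := (Ioo_subset_Ioo_iff h1).1 (h2.trans hsub)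
        have h6 := hcomp u v h1 h2 h3 h4
        linarith [hchord u v h5.1 h1 h5.2 h6.1 h6.2]
    rw [hc _ hfin] at this
    linarith

theorem setIntegral_mul_defect {y : ℝ → ℝ} (hy : Integrable y)
    (hy2 : Integrable (fun x => y x ^ 2)) (P Q : ℝ) {V : Set ℝ} (hV : volume V ≠ ⊤) :
    ∫ x in V, (P - y x) * (Q + y x) =
      P * Q * volume.real V + (P - Q) * (∫ x in V, y x) - ∫ x in V, y x ^ 2 := by
  have h : (fun x => (P - y x) * (Q + y x)) = fun x => P * Q + (P - Q) * y x - y x ^ 2 := by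
    ext x; ring
  have hc : Integrable (fun _ => P * Q) (volume.restrict V) := integrableOn_const hV
  have hl : Integrable (fun x => (P - Q) * y x) (volume.restrict V) :=
    (hy.const_mul _).integrableOn
  rw [h, integral_sub (f := fun x => P * Q + (P - Q) * y x) (hc.add hl) hy2.integrableOn, integral_add hc hl, setIntegral_const, integral_const_mul, smul_eq_mul]
  ring

/-- The rising sun lemma: off `U` the function is antitone, and the components of `U` are chords. -/
theorem exists_risingSun {F : ℝ → ℝ} (hF : Continuous F) {a b : ℝ} (hab : a < b)
    (hba : F b ≤ F a) :
    ∃ U ⊆ Ioo a b, IsOpen U ∧ AntitoneOn F (Ioo a b \ U) ∧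
      ∀ u v, u < v → Ioo u v ⊆ U → u ∉ U → v ∉ U → F u = F v := by
  have hKc : IsCompact (Icc a b ∩ F ⁻¹' {F a}) :=
    isCompact_Icc.inter_right (isClosed_singleton.preimage hF)
  obtain ⟨c, ⟨hc, hFc⟩, hcmax⟩ := hKc.exists_isGreatest ⟨a, left_mem_Icc.2 hab.le, rfl⟩
  simp only [mem_preimage, mem_singleton_iff] at hFc
  have hafter : ∀ x, c ≤ x → x ≤ b → F x ≤ F a := by
    intro x hcx hxb
    by_contra! hlt
    obtain ⟨w, hw, hwe⟩ := intermediate_value_Icc' hxb hF.continuousOn ⟨hba, hlt.le⟩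
    have := hcmax ⟨⟨hc.1.trans (hcx.trans hw.1), hw.2⟩, hwe⟩
    have hwx : w = x := le_antisymm (this.trans hcx) hw.1
    rw [hwx] at hwe
    linarith
  refine ⟨Ioo a b ∩ ({x | x < c} ∪ ⋃ z ∈ Icc a b, {x | x < z ∧ F x < F z}), inter_subset_left,
    isOpen_Ioo.inter ((isOpen_lt continuous_id continuous_const).union
      (isOpen_biUnion fun z _ => (isOpen_lt continuous_id continuous_const).inter
        (isOpen_lt hF continuous_const))), ?_, ?_⟩
  · intro x hx z hz hxz
    rcases hxz.eq_or_lt with rfl | hlt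
    · exact le_rfl
    by_contra! hF'
    exact hx.2 ⟨hx.1, Or.inr (mem_biUnion (Ioo_subset_Icc_self hz.1) ⟨hlt, hF'⟩)⟩
  · intro u v huv hsub hu hv
    have h5 := (Ioo_subset_Ioo_iff huv).1 (hsub.trans inter_subset_left)
    have houtside : ∀ x, x ∈ Ioo a b → x ∉ Ioo a b ∩ ({x | x < c} ∪ ⋃ z ∈ Icc a b,
        {x | x < z ∧ F x < F z}) → c ≤ x ∧ ∀ z, x < z → z ≤ b → F z ≤ F x := by
      intro x hx hxU
      constructor
      · by_contra! h
        exact hxU ⟨hx, Or.inl h⟩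
      · intro z hxz hz
        by_contra! h
        exact hxU ⟨hx, Or.inr (mem_biUnion ⟨hx.1.le.trans hxz.le, hz⟩ ⟨hxz, h⟩)⟩
    have hinside : ∀ x, x ∈ Ioo u v → c ≤ x → ∃ z, x < z ∧ z ≤ b ∧ F x < F z := by
      intro x hx hcx
      rcases (hsub hx).2 with h | h
      · exact absurd h (not_lt.2 hcx)
      · simp only [mem_iUnion] at h
        obtain ⟨z, hz, h1, h2⟩ := h
        exact ⟨z, h1, hz.2, h2⟩
    have hv' : c ≤ v ∧ ∀ z, v < z → z ≤ b → F z ≤ F v := by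
      rcases h5.2.eq_or_lt with h | h
      · exact ⟨h ▸ hc.2, fun z h1 h2 => absurd (h1.trans_le h2) (by rw [h]; exact lt_irrefl _)⟩
      · exact houtside v ⟨h5.1.trans_lt huv, h⟩ hv
    by_cases huc : c ≤ u
    · have hu' : F v ≤ F u := by
        rcases h5.1.eq_or_lt with h | h
        · rw [← h]; exact hafter v hv'.1 h5.2
        · exact (houtside u ⟨h, huv.trans_le h5.2⟩ hu).2 v huv h5.2
      refine le_antisymm ?_ hu'
      by_contra! hlt
      obtain ⟨w, hw, hwe⟩ := intermediate_value_Icc' huv.le hF.continuousOn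
        (show (F u + F v) / 2 ∈ _ from ⟨by linarith, by linarith⟩)
      obtain ⟨m, hm, hmax⟩ := (isCompact_Icc (a := w) (b := b)).exists_isMaxOn
        ⟨w, left_mem_Icc.2 (hw.2.trans h5.2)⟩ hF.continuousOn
      have hFm : F v < F m := by
        have := hmax (left_mem_Icc.2 (hw.2.trans h5.2))
        simp only [mem_ofPred_eq] at this
        linarith
      have hwu : u < w := lt_of_le_of_ne hw.1 fun h => by rw [← h] at hwe; linarith
      have hmv : m < v := by
        by_contra! h
        rcases h.eq_or_lt with h | h
        · rw [h] at hFm; exact lt_irrefl _ hFm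
        · linarith [hv'.2 m h hm.2]
      obtain ⟨z, h1, h2, h3⟩ := hinside m ⟨hwu.trans_le hm.1, hmv⟩
        (huc.trans (hw.1.trans hm.1))
      have := hmax (show z ∈ Icc w b from ⟨hm.1.trans h1.le, h2⟩)
      simp only [mem_ofPred_eq] at this
      linarith
    · push Not at huc
      have hua : u = a := by
        refine le_antisymm ?_ h5.1
        by_contra! h
        exact absurd (houtside u ⟨h, huv.trans_le h5.2⟩ hu).1 (not_le.2 huc)
      have hcv : v = c := by
        refine le_antisymm ?_ hv'.1
        by_contra! h
        obtain ⟨z, h1, h2, h3⟩ := hinside c ⟨huc, h⟩ le_rfl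
        linarith [hafter z h1.le h2]
      rw [hua, hcv, hFc]

theorem defect_bound_of_nonpos {a b s P Q A B κ : ℝ} {y : ℝ → ℝ} (hy : Integrable y)
    (hbd : ∀ x, y x ∈ Icc (-Q) P) (hP : 0 ≤ P) (hQ : 0 ≤ Q) (hs : 0 < s) (hA : 0 ≤ A)
    (hB : 0 ≤ B) (hlen : s + A + B = b - a) (hmean : ∫ x in Ioo a b, y x = A * P - B * Q)
    (hneg : A * P - B * Q ≤ 0)
    (hchord : ∀ u v, a ≤ u → u < v → v ≤ b → v - u ≤ s → ∫ x in Ioo u v, y x = 0 →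
      ∫ x in Ioo u v, y x ^ 2 ≤ κ * (v - u)) (hκ : 0 ≤ κ) :
    s * (P * Q) - ∫ x in Ioo a b, (P - y x) * (Q + y x) ≤ κ * s := by
  have hab : a < b := by linarith
  have hy2 := Integrable.sq_of_mem_Icc hy hbd
  set F : ℝ → ℝ := fun x => ∫ t in a..x, y t with hFdef
  have hF : Continuous F := hy.continuous_primitive a
  have hFint : ∀ u v, u ≤ v → ∫ x in Ioo u v, y x = F v - F u :=
    fun u v huv => integral_Ioo_eq_sub hy a huv
  have hh0 : ∀ x, 0 ≤ (P - y x) * (Q + y x) := fun x =>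
    mul_nonneg (by linarith [(hbd x).2]) (by linarith [(hbd x).1])
  have hfinI : ∀ V ⊆ Ioo a b, volume V ≠ ⊤ := fun V hV =>
    ((measure_mono hV).trans_lt measure_Ioo_lt_top).ne
  have hhint : ∀ V ⊆ Ioo a b, IntegrableOn (fun x => (P - y x) * (Q + y x)) V := by
    intro V hV
    have h : (fun x => (P - y x) * (Q + y x)) = fun x => P * Q + (P - Q) * y x - y x ^ 2 := by
      ext x; ring
    rw [h]
    exact ((integrableOn_const (hfinI V hV)).add (hy.const_mul _).integrableOn).sub
      hy2.integrableOn
  have hlarge : ∀ V ⊆ Ioo a b, s ≤ volume.real V → ∫ x in V, y x = 0 →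
      ∫ x in V, y x ^ 2 ≤ κ * volume.real V →
      s * (P * Q) - ∫ x in Ioo a b, (P - y x) * (Q + y x) ≤ κ * s := by
    intro V hV hsV h0 h2
    have hD : ∫ x in V, (P - y x) * (Q + y x) ≤ ∫ x in Ioo a b, (P - y x) * (Q + y x) :=
      setIntegral_mono_set (hhint _ subset_rfl) (Filter.Eventually.of_forall hh0)
        hV.eventuallyLE
    have hD0 : 0 ≤ ∫ x in Ioo a b, (P - y x) * (Q + y x) := integral_nonneg hh0
    rw [setIntegral_mul_defect hy hy2 P Q (hfinI V hV), h0] at hD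
    rcases le_total (P * Q) κ with h | h
    · nlinarith
    · nlinarith
  by_cases hex : ∃ p q, a ≤ p ∧ q ≤ b ∧ s ≤ q - p ∧ F p = F q
  · obtain ⟨p, q, hp, hq, hsl, hFpq, hexc⟩ := exists_minimal_chord hF hs hex
    have hpq : p < q := by linarith
    set U := Ioo p q ∩ {x | F x ≠ F p} with hUdef
    have hU : IsOpen U := isOpen_Ioo.inter (isOpen_ne_fun hF continuous_const)
    have hI : Ioo p q ⊆ Ioo a b := Ioo_subset_Ioo hp hq
    have hUs : U ⊆ Ioo a b := inter_subset_left.trans hI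
    have hcomp : ∀ u v, u < v → Ioo u v ⊆ U → u ∉ U → v ∉ U →
        v - u ≤ s ∧ ∫ x in Ioo u v, y x = 0 := by
      intro u v huv hsub hu hv
      have h5 := (Ioo_subset_Ioo_iff huv).1 (hsub.trans inter_subset_left)
      have hFu : F u = F p := by
        rcases h5.1.eq_or_lt with h | h
        · rw [h]
        · by_contra hne
          exact hu ⟨⟨h, huv.trans_le h5.2⟩, hne⟩
      have hFv : F v = F p := by
        rcases h5.2.eq_or_lt with h | h
        · rw [h, hFpq]
        · by_contra hne
          exact hv ⟨⟨h5.1.trans_lt huv, h⟩, hne⟩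
      refine ⟨hexc u v h5.1 huv h5.2 hFu hFv fun x hx => (hsub hx).2, ?_⟩
      rw [hFint u v huv.le, hFu, hFv, sub_self]
    obtain ⟨-, h2⟩ := setIntegral_sq_le_of_components hy hy2 hchord hU hUs hcomp
    have hZ : ∀ᵐ x, x ∈ Ioo p q \ U → y x = 0 := by
      have hZF : ∀ x ∈ Ioo p q \ U, F x = F p := by
        intro x hx
        by_contra hne
        exact hx.2 ⟨hx.1, hne⟩
      have h1 := ae_nonpos_of_antitoneOn_primitive hy (c := a) (Z := Ioo p q \ U)
        fun x hx z hz _ => ((hZF z hz).trans (hZF x hx).symm).le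
      have h2 := ae_nonpos_of_antitoneOn_primitive hy.neg (c := a) (Z := Ioo p q \ U)
        fun x hx z hz _ => by
          simp only [Pi.neg_apply, intervalIntegral.integral_neg]
          exact neg_le_neg ((hZF x hx).trans (hZF z hz).symm).le
      filter_upwards [h1, h2] with x h1 h2 hx
      have := h2 hx
      simp only [Pi.neg_apply] at this
      linarith [h1 hx]
    have hsplit : ∫ x in Ioo p q, y x ^ 2 = ∫ x in U, y x ^ 2 := by
      refine (setIntegral_eq_of_subset_of_ae_sdiff_eq_zero measurableSet_Ioo.nullMeasurableSet
        inter_subset_left ?_)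
      filter_upwards [hZ] with x hx hxZ
      simp [hx hxZ]
    refine hlarge (Ioo p q) hI ?_ ?_ ?_
    · rw [Real.volume_real_Ioo_of_le hpq.le]; exact hsl
    · rw [hFint p q hpq.le, hFpq, sub_self]
    · rw [hsplit]
      exact h2.trans (mul_le_mul_of_nonneg_left
        (measureReal_mono inter_subset_left measure_Ioo_lt_top.ne) hκ)
  · have hFab : F b ≤ F a := by
      have := hFint a b hab.le
      linarith
    obtain ⟨U, hUs, hU, hanti, hcompF⟩ := exists_risingSun hF hab hFab
    have hcomp : ∀ u v, u < v → Ioo u v ⊆ U → u ∉ U → v ∉ U →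
        v - u ≤ s ∧ ∫ x in Ioo u v, y x = 0 := by
      intro u v huv hsub hu hv
      have h5 := (Ioo_subset_Ioo_iff huv).1 (hsub.trans hUs)
      have hFuv := hcompF u v huv hsub hu hv
      refine ⟨?_, by rw [hFint u v huv.le, hFuv, sub_self]⟩
      by_contra! h
      exact hex ⟨u, v, h5.1, h5.2, h.le, hFuv⟩
    obtain ⟨h0, h2⟩ := setIntegral_sq_le_of_components hy hy2 hchord hU hUs hcomp
    rcases le_total s (volume.real U) with hsU | hsU
    · exact hlarge U hUs hsU h0 h2
    have hZs : Ioo a b \ U ⊆ Ioo a b := sdiff_subset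
    have hZm : MeasurableSet (Ioo a b \ U) := measurableSet_Ioo.diff hU.measurableSet
    have hvol : volume.real (Ioo a b \ U) = s + A + B - volume.real U := by
      rw [measureReal_sdiff hUs hU.measurableSet measure_Ioo_lt_top.ne,
        Real.volume_real_Ioo_of_le hab.le, hlen]
    have hsplit : ∀ f : ℝ → ℝ, IntegrableOn f (Ioo a b) →
        ∫ x in Ioo a b, f x = (∫ x in U, f x) + ∫ x in Ioo a b \ U, f x := by
      intro f hf
      rw [setIntegral_sdiff hU.measurableSet hf hUs]
      ring
    have hyZ : ∫ x in Ioo a b \ U, y x = A * P - B * Q := by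
      have := hsplit y hy.integrableOn
      rw [h0, hmean] at this
      linarith
    have hlow : ∫ x in Ioo a b \ U, P * (Q + y x) ≤
        ∫ x in Ioo a b \ U, (P - y x) * (Q + y x) := by
      refine setIntegral_mono_on_ae
        (((integrableOn_const (hfinI _ hZs)).add hy.integrableOn).const_mul P)
        (hhint _ hZs) hZm ?_
      filter_upwards [ae_nonpos_of_antitoneOn_primitive hy hanti] with x hx hxZ
      nlinarith [hx hxZ, (hbd x).1]
    have hcQ : Integrable (fun _ => Q) (volume.restrict (Ioo a b \ U)) :=
      integrableOn_const (hfinI _ hZs)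
    rw [integral_const_mul, integral_add hcQ hy.integrableOn, hyZ,
      setIntegral_const, hvol, smul_eq_mul] at hlow
    have hD := hsplit _ (hhint _ subset_rfl)
    rw [setIntegral_mul_defect hy hy2 P Q (hfinI U hUs), h0] at hD
    nlinarith [mul_nonneg (mul_nonneg hA hP) (add_nonneg hP hQ), mul_nonneg hκ (sub_nonneg.2 hsU)]

/-- If `y` takes values in `[-Q, P]` and its mean square over every short interval of mean zero is
at most `κ`, then `P Q - κ` is controlled by the total mass of `(P - y) (Q + y)`. -/
theorem defect_bound {a b s P Q A B κ : ℝ} {y : ℝ → ℝ} (hy : Integrable y)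
    (hbd : ∀ x, y x ∈ Icc (-Q) P) (hP : 0 ≤ P) (hQ : 0 ≤ Q) (hs : 0 < s) (hA : 0 ≤ A)
    (hB : 0 ≤ B) (hlen : s + A + B = b - a) (hmean : ∫ x in Ioo a b, y x = A * P - B * Q)
    (hchord : ∀ u v, a ≤ u → u < v → v ≤ b → v - u ≤ s → ∫ x in Ioo u v, y x = 0 →
      ∫ x in Ioo u v, y x ^ 2 ≤ κ * (v - u)) (hκ : 0 ≤ κ) :
    s * (P * Q) - ∫ x in Ioo a b, (P - y x) * (Q + y x) ≤ κ * s := by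
  rcases le_total (A * P - B * Q) 0 with h | h
  · exact defect_bound_of_nonpos hy hbd hP hQ hs hA hB hlen hmean h hchord hκ
  · have := defect_bound_of_nonpos (y := fun x => - y x) (P := Q) (Q := P) (A := B) (B := A)
      (a := a) (b := b) (s := s) (κ := κ) hy.neg
      (fun x => ⟨by linarith [(hbd x).2], by linarith [(hbd x).1]⟩) hQ hP hs hB hA (by linarith)
      (by rw [integral_neg, hmean]; ring) (by linarith)
      (fun u v h1 h2 h3 h4 h5 => by
        rw [integral_neg, neg_eq_zero] at h5
        simpa using hchord u v h1 h2 h3 h4 h5) hκ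
    have he : ∀ x, (P - y x) * (Q + y x) = (Q - -y x) * (P + -y x) := fun x => by ring
    simp only [he]
    linarith

theorem volume_superlevel_ne_top (a b l : ℝ) (φ : ℝ → ℝ) :
    volume {s ∈ Ioo a b | l < φ s} ≠ ⊤ :=
  ((measure_mono (sep_subset _ _)).trans_lt measure_Ioo_lt_top).ne

theorem volume_superlevel_anti (a b : ℝ) (φ : ℝ → ℝ) :
    Antitone fun l => volume {s ∈ Ioo a b | l < φ s} :=
  fun _ _ h => measure_mono fun _ hs => ⟨hs.1, h.trans_lt hs.2⟩

theorem lt_decRearrangement_iff {a b : ℝ} {φ : ℝ → ℝ}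
    (hφ : AEMeasurable φ (volume.restrict (Ioo a b))) {t : ℝ} (ht : t ∈ Ioo a b) (l : ℝ) :
    l < decRearrangement a b φ t ↔
      ENNReal.ofReal (t - a) < volume {s ∈ Ioo a b | l < φ s} := by
  set G : ℝ → ENNReal := fun l => volume {s ∈ Ioo a b | l < φ s} with hG
  have hanti : Antitone G := volume_superlevel_anti a b φ
  set S : Set ℝ := {l | G l ≤ ENNReal.ofReal (t - a)} with hS
  have hnull : ∀ l, NullMeasurableSet {s ∈ Ioo a b | l < φ s} := fun l => by
    have := (nullMeasurableSet_lt (μ := volume.restrict (Ioo a b)) aemeasurable_const hφ :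
      NullMeasurableSet {s | l < φ s} _)
    exact (nullMeasurableSet_restrict measurableSet_Ioo.nullMeasurableSet).1 this |>.congr
      (by rw [inter_comm]; rfl)
  have hne : S.Nonempty := by
    have h := tendsto_measure_iInter_atTop (μ := volume)
      (s := fun n : ℕ => {s ∈ Ioo a b | (n : ℝ) < φ s}) (fun n => hnull n)
      (fun m n hmn s hs => ⟨hs.1, lt_of_le_of_lt (Nat.cast_le.2 hmn) hs.2⟩)
      ⟨0, volume_superlevel_ne_top _ _ _ _⟩
    have h0 : (⋂ n : ℕ, {s ∈ Ioo a b | (n : ℝ) < φ s}) = ∅ := by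
      refine eq_empty_of_forall_notMem fun s hs => ?_
      obtain ⟨n, hn⟩ := exists_nat_ge (φ s)
      exact absurd (mem_iInter.1 hs n).2 (not_lt.2 hn)
    rw [h0, measure_empty] at h
    have hpos : (0 : ENNReal) < ENNReal.ofReal (t - a) :=
      ENNReal.ofReal_pos.2 (sub_pos.2 ht.1)
    obtain ⟨n, hn⟩ := (h.eventually (gt_mem_nhds hpos)).exists
    exact ⟨n, hn.le⟩
  have hbdd : BddBelow S := by
    have h := tendsto_measure_iUnion_atTop (μ := volume)
      (s := fun n : ℕ => {s ∈ Ioo a b | (-n : ℝ) < φ s})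
      (fun m n hmn s hs => ⟨hs.1, lt_of_le_of_lt (neg_le_neg (Nat.cast_le.2 hmn)) hs.2⟩)
    have h0 : (⋃ n : ℕ, {s ∈ Ioo a b | (-n : ℝ) < φ s}) = Ioo a b := by
      refine subset_antisymm (iUnion_subset fun n => sep_subset _ _) fun s hs => ?_
      obtain ⟨n, hn⟩ := exists_nat_gt (-φ s)
      exact mem_iUnion.2 ⟨n, hs, by linarith⟩
    rw [h0, Real.volume_Ioo] at h
    have hlt : ENNReal.ofReal (t - a) < ENNReal.ofReal (b - a) :=
      (ENNReal.ofReal_lt_ofReal_iff (by linarith [ht.1, ht.2])).2 (by linarith [ht.2])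
    obtain ⟨n, hn⟩ := (h.eventually (lt_mem_nhds hlt)).exists
    refine ⟨-n, fun l hl => ?_⟩
    by_contra! hlt
    exact absurd (hn.trans_le ((hanti hlt.le).trans hl)) (lt_irrefl _)
  rw [← not_le, ← not_le, not_iff_not]
  change sInf S ≤ l ↔ G l ≤ _
  refine ⟨fun h => ?_, fun h => csInf_le hbdd h⟩
  have hU : {s ∈ Ioo a b | l < φ s} = ⋃ n : ℕ, {s ∈ Ioo a b | l + 1 / ((n : ℝ) + 1) < φ s} := by
    ext s
    simp only [mem_ofPred_eq, mem_iUnion]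
    constructor
    · rintro ⟨h1, h2⟩
      obtain ⟨n, hn⟩ := exists_nat_one_div_lt (sub_pos.2 h2)
      exact ⟨n, h1, by linarith⟩
    · rintro ⟨n, h1, h2⟩
      exact ⟨h1, by linarith [Nat.one_div_pos_of_nat (α := ℝ) (n := n)]⟩
  have hmono : Monotone fun n : ℕ => {s ∈ Ioo a b | l + 1 / ((n : ℝ) + 1) < φ s} :=
    fun m n hmn s hs => ⟨hs.1, by
      linarith [hs.2, Nat.one_div_le_one_div (α := ℝ) hmn]⟩
  change volume {s ∈ Ioo a b | l < φ s} ≤ _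
  rw [hU, hmono.measure_iUnion]
  refine iSup_le fun n => ?_
  obtain ⟨l', hl', hlt⟩ := exists_lt_of_csInf_lt hne
    (h.trans_lt (lt_add_of_pos_right l (Nat.one_div_pos_of_nat (α := ℝ) (n := n))))
  exact (hanti hlt.le).trans hl'

theorem antitoneOn_decRearrangement {a b : ℝ} {φ : ℝ → ℝ}
    (hφ : AEMeasurable φ (volume.restrict (Ioo a b))) :
    AntitoneOn (decRearrangement a b φ) (Ioo a b) := by
  intro t ht t' ht' htt'
  refine le_of_forall_lt fun l hl => ?_
  rw [lt_decRearrangement_iff hφ ht'] at hl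
  rw [lt_decRearrangement_iff hφ ht]
  exact (ENNReal.ofReal_le_ofReal (by linarith)).trans_lt hl

theorem identDistrib_decRearrangement {a b : ℝ} {φ : ℝ → ℝ}
    (hφ : AEMeasurable φ (volume.restrict (Ioo a b))) :
    ProbabilityTheory.IdentDistrib φ (decRearrangement a b φ) (volume.restrict (Ioo a b))
      (volume.restrict (Ioo a b)) := by
  have hf : AEMeasurable (decRearrangement a b φ) (volume.restrict (Ioo a b)) :=
    aemeasurable_restrict_of_antitoneOn measurableSet_Ioo (antitoneOn_decRearrangement hφ)
  refine ⟨hφ, hf, ?_⟩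
  have hIoi : ∀ l, (Measure.map φ (volume.restrict (Ioo a b))) (Ioi l) =
      (Measure.map (decRearrangement a b φ) (volume.restrict (Ioo a b))) (Ioi l) := by
    intro l
    rw [Measure.map_apply_of_aemeasurable hφ measurableSet_Ioi,
      Measure.map_apply_of_aemeasurable hf measurableSet_Ioi,
      Measure.restrict_apply' measurableSet_Ioo, Measure.restrict_apply' measurableSet_Ioo]
    have h1 : φ ⁻¹' Ioi l ∩ Ioo a b = {s ∈ Ioo a b | l < φ s} := by
      rw [inter_comm]; rfl
    set g := (volume {s ∈ Ioo a b | l < φ s}).toReal with hg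
    have hgE : volume {s ∈ Ioo a b | l < φ s} = ENNReal.ofReal g :=
      (ENNReal.ofReal_toReal (volume_superlevel_ne_top a b l φ)).symm
    have hgle : ENNReal.ofReal g ≤ ENNReal.ofReal (b - a) := by
      rw [← hgE, ← Real.volume_Ioo]
      exact measure_mono (sep_subset _ _)
    have h2 : decRearrangement a b φ ⁻¹' Ioi l ∩ Ioo a b = Ioo a (a + g) := by
      ext t
      simp only [mem_inter_iff, mem_preimage, mem_Ioi]
      constructor
      · rintro ⟨h, ht⟩
        rw [lt_decRearrangement_iff hφ ht, hgE] at h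
        exact ⟨ht.1, by linarith [(ENNReal.ofReal_lt_ofReal_iff_of_nonneg (sub_nonneg.2 ht.1.le)).1 h]⟩
      · intro ht
        have hg0 : 0 < g := by linarith [ht.1, ht.2]
        have hgb : g ≤ b - a := by
          by_contra! hlt
          exact absurd hgle (not_le.2 ((ENNReal.ofReal_lt_ofReal_iff hg0).2 hlt))
        have ht' : t ∈ Ioo a b := ⟨ht.1, by linarith [ht.2]⟩
        refine ⟨?_, ht'⟩
        rw [lt_decRearrangement_iff hφ ht', hgE]
        exact (ENNReal.ofReal_lt_ofReal_iff hg0).2 (by linarith [ht.2])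
    rw [h1, h2, hgE, Real.volume_Ioo]
    congr 1
    ring
  refine Measure.ext_of_Iic _ _ fun l => ?_
  rw [← compl_Ioi, measure_compl measurableSet_Ioi (measure_ne_top _ _),
    measure_compl measurableSet_Ioi (measure_ne_top _ _), hIoi l,
    Measure.map_apply_of_aemeasurable hφ MeasurableSet.univ,
    Measure.map_apply_of_aemeasurable hf MeasurableSet.univ]
  rfl

theorem integrableOn_of_memLp_two {φ : ℝ → ℝ} {a b c d : ℝ}
    (hφ : MemLp φ 2 (volume.restrict (Ioo a b))) (hc : a ≤ c) (hd : d ≤ b) :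
    IntegrableOn φ (Ioo c d) ∧ IntegrableOn (fun x => φ x ^ 2) (Ioo c d) := by
  have h := Ioo_subset_Ioo hc hd
  exact ⟨IntegrableOn.mono_set (hφ.integrable one_le_two) h,
    IntegrableOn.mono_set hφ.integrable_sq h⟩

theorem oscSq_eq (φ : ℝ → ℝ) {c d : ℝ} (hcd : c < d) :
    oscSq φ c d = (∫ x in Ioo c d, φ x ^ 2) / (d - c) - ((∫ x in Ioo c d, φ x) / (d - c)) ^ 2 := by
  simp only [oscSq, setAverage_eq, Real.volume_real_Ioo_of_le hcd.le, smul_eq_mul,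
    div_eq_inv_mul]

theorem oscSq_eq_shift {φ : ℝ → ℝ} {c d : ℝ} (hcd : c < d) (h1 : IntegrableOn φ (Ioo c d))
    (h2 : IntegrableOn (fun x => φ x ^ 2) (Ioo c d)) (k : ℝ) :
    oscSq φ c d = (∫ x in Ioo c d, (φ x - k) ^ 2) / (d - c) -
      ((∫ x in Ioo c d, φ x) / (d - c) - k) ^ 2 := by
  have hk : IntegrableOn (fun _ : ℝ => k ^ 2) (Ioo c d) :=
    integrableOn_const measure_Ioo_lt_top.ne
  have he : (fun x => (φ x - k) ^ 2) = fun x => φ x ^ 2 - 2 * k * φ x + k ^ 2 := by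
    ext x; ring
  have hl : IntegrableOn (fun x => φ x ^ 2 - 2 * k * φ x) (Ioo c d) := h2.sub (h1.const_mul _)
  rw [oscSq_eq φ hcd, he, integral_add hl hk, integral_sub h2 (h1.const_mul _), integral_const_mul,
    setIntegral_const, Real.volume_real_Ioo_of_le hcd.le, smul_eq_mul]
  have : d - c ≠ 0 := by linarith
  field_simp
  ring

theorem oscSq_le_shift {φ : ℝ → ℝ} {c d : ℝ} (hcd : c < d) (h1 : IntegrableOn φ (Ioo c d))
    (h2 : IntegrableOn (fun x => φ x ^ 2) (Ioo c d)) (k : ℝ) :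
    oscSq φ c d ≤ (∫ x in Ioo c d, (φ x - k) ^ 2) / (d - c) := by
  rw [oscSq_eq_shift hcd h1 h2 k]
  linarith [sq_nonneg ((∫ x in Ioo c d, φ x) / (d - c) - k)]

theorem oscSq_nonneg {φ : ℝ → ℝ} {c d : ℝ} (hcd : c < d) (h1 : IntegrableOn φ (Ioo c d))
    (h2 : IntegrableOn (fun x => φ x ^ 2) (Ioo c d)) : 0 ≤ oscSq φ c d := by
  rw [oscSq_eq_shift hcd h1 h2 ((∫ x in Ioo c d, φ x) / (d - c)), sub_self]
  have : 0 ≤ ∫ x in Ioo c d, (φ x - (∫ x in Ioo c d, φ x) / (d - c)) ^ 2 :=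
    integral_nonneg fun x => sq_nonneg _
  have := div_nonneg this (sub_nonneg.2 hcd.le)
  linarith

/-- Composition with a contraction does not increase the oscillation. -/
theorem oscSq_comp_le {φ g : ℝ → ℝ} {c d : ℝ} (hcd : c < d) (hg : LipschitzWith 1 g)
    (hφ : MemLp φ 2 (volume.restrict (Ioo c d)))
    (hgφ : MemLp (g ∘ φ) 2 (volume.restrict (Ioo c d))) :
    oscSq (g ∘ φ) c d ≤ oscSq φ c d := by
  obtain ⟨h1, h2⟩ := integrableOn_of_memLp_two hφ le_rfl le_rfl
  obtain ⟨h3, h4⟩ := integrableOn_of_memLp_two hgφ le_rfl le_rfl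
  set k := (∫ x in Ioo c d, φ x) / (d - c) with hk
  refine (oscSq_le_shift hcd h3 h4 (g k)).trans ?_
  rw [oscSq_eq_shift hcd h1 h2 k, ← hk, sub_self, zero_pow two_ne_zero, sub_zero]
  refine div_le_div_of_nonneg_right ?_ (sub_nonneg.2 hcd.le)
  refine integral_mono (hgφ.sub (memLp_const (g k))).integrable_sq
    (hφ.sub (memLp_const k)).integrable_sq fun x => ?_
  have := hg.dist_le_mul (φ x) k
  rw [Real.dist_eq, Real.dist_eq, NNReal.coe_one, one_mul] at this
  exact sq_le_sq.2 this

theorem setIntegral_Ioo_split {f : ℝ → ℝ} {a b c d : ℝ} (hf : IntegrableOn f (Ioo a b))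
    (hac : a ≤ c) (hcd : c ≤ d) (hdb : d ≤ b) :
    ∫ x in Ioo a b, f x =
      (∫ x in Ioo a c, f x) + (∫ x in Ioo c d, f x) + ∫ x in Ioo d b, f x := by
  have h : ∀ u v, a ≤ u → u ≤ v → v ≤ b → IntervalIntegrable f volume u v := fun u v h1 h2 h3 => by
    rw [intervalIntegrable_iff_integrableOn_Ioo_of_le h2]
    exact hf.mono_set (Ioo_subset_Ioo h1 h3)
  simp only [← integral_Ioc_eq_integral_Ioo]
  rw [← intervalIntegral.integral_of_le hac, ← intervalIntegral.integral_of_le hcd,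
    ← intervalIntegral.integral_of_le hdb,
    ← intervalIntegral.integral_of_le (hac.trans (hcd.trans hdb)),
    intervalIntegral.integral_add_adjacent_intervals (h a c le_rfl hac (hcd.trans hdb))
      (h c d hac hcd hdb),
    intervalIntegral.integral_add_adjacent_intervals (h a d le_rfl (hac.trans hcd) hdb)
      (h d b (hac.trans hcd) hdb le_rfl)]

theorem lipschitzWith_clamp (m M : ℝ) : LipschitzWith 1 fun x : ℝ => max m (min x M) :=
  (LipschitzWith.id.min_const M).const_max m

theorem memLp_clamp_comp {φ : ℝ → ℝ} {c d m M : ℝ} (hmM : m ≤ M)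
    (hφ : AEStronglyMeasurable φ (volume.restrict (Ioo c d))) :
    MemLp ((fun x => max m (min x M)) ∘ φ) 2 (volume.restrict (Ioo c d)) := by
  refine MemLp.of_bound ((lipschitzWith_clamp m M).continuous.comp_aestronglyMeasurable hφ)
    (max |m| |M|) (Filter.Eventually.of_forall fun x => ?_)
  exact abs_le_max_abs_abs (le_max_left _ _) (max_le hmM (min_le_right _ _))

/-- The integral of a function of the truncation of `φ` to the range of its rearrangement over
`(c, d)`. -/
theorem integral_comp_clamp {a b c d : ℝ} {φ H : ℝ → ℝ} (hac : a < c) (hcd : c < d) (hdb : d < b)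
    (hφ : MemLp φ 2 (volume.restrict (Ioo a b))) (hH : Continuous H) :
    ∫ x in Ioo a b, H (max (decRearrangement a b φ d) (min (φ x) (decRearrangement a b φ c))) =
      (c - a) * H (decRearrangement a b φ c) + (∫ x in Ioo c d, H (decRearrangement a b φ x)) +
        (b - d) * H (decRearrangement a b φ d) := by
  set f := decRearrangement a b φ with hf
  have hφm : AEMeasurable φ (volume.restrict (Ioo a b)) := hφ.aestronglyMeasurable.aemeasurable
  have hanti : AntitoneOn f (Ioo a b) := antitoneOn_decRearrangement hφm
  have hc : c ∈ Ioo a b := ⟨hac, hcd.trans hdb⟩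
  have hd : d ∈ Ioo a b := ⟨hac.trans hcd, hdb⟩
  have hmM : f d ≤ f c := hanti hc hd hcd.le
  set g : ℝ → ℝ := fun x => max (f d) (min x (f c)) with hg
  have hHg : Continuous fun x => H (g x) := hH.comp (lipschitzWith_clamp _ _).continuous
  have hid := identDistrib_decRearrangement hφm
  have h1 : ∫ x in Ioo a b, H (g (φ x)) = ∫ x in Ioo a b, H (g (f x)) :=
    (hid.comp hHg.measurable).integral_eq
  obtain ⟨C, hC⟩ := (isCompact_Icc (a := f d) (b := f c)).exists_bound_of_continuousOn
    hH.continuousOn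
  have hint : IntegrableOn (fun x => H (g (f x))) (Ioo a b) := by
    refine IntegrableOn.of_bound measure_Ioo_lt_top
      (hHg.measurable.comp_aemeasurable hid.aemeasurable_snd).aestronglyMeasurable C
      (Filter.Eventually.of_forall fun x => hC _ ⟨le_max_left _ _, max_le hmM (min_le_right _ _)⟩)
  change ∫ x in Ioo a b, H (g (φ x)) = _
  rw [h1, setIntegral_Ioo_split hint hac.le hcd.le hdb.le]
  congr 1
  · congr 1
    · rw [setIntegral_congr_fun (g := fun _ => H (f c)) measurableSet_Ioo, setIntegral_const,
        Real.volume_real_Ioo_of_le hac.le, smul_eq_mul]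
      intro x hx
      have : f c ≤ f x := hanti ⟨hx.1, hx.2.trans hc.2⟩ hc hx.2.le
      simp only [hg, min_eq_right this, max_eq_right hmM]
    · refine setIntegral_congr_fun measurableSet_Ioo fun x hx => ?_
      have hx' : x ∈ Ioo a b := ⟨hac.trans hx.1, hx.2.trans hdb⟩
      have h1 : f x ≤ f c := hanti hc hx' hx.1.le
      have h2 : f d ≤ f x := hanti hx' hd hx.2.le
      simp only [hg, min_eq_left h1, max_eq_right h2]
  · rw [setIntegral_congr_fun (g := fun _ => H (f d)) measurableSet_Ioo, setIntegral_const,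
      Real.volume_real_Ioo_of_le hdb.le, smul_eq_mul]
    intro x hx
    have : f x ≤ f d := hanti hd ⟨hd.1.trans hx.1, hx.2⟩ hx.1.le
    simp only [hg, min_eq_left (this.trans hmM), max_eq_left this]

theorem memLp_decRearrangement {a b : ℝ} {φ : ℝ → ℝ}
    (hφ : MemLp φ 2 (volume.restrict (Ioo a b))) :
    MemLp (decRearrangement a b φ) 2 (volume.restrict (Ioo a b)) :=
  (identDistrib_decRearrangement hφ.aestronglyMeasurable.aemeasurable).memLp_iff.1 hφ

theorem oscSq_decRearrangement_le_of_interior {a b c d κ : ℝ} {φ : ℝ → ℝ} (hac : a < c)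
    (hcd : c < d) (hdb : d < b) (hφ : MemLp φ 2 (volume.restrict (Ioo a b))) (hκ : 0 ≤ κ)
    (hosc : ∀ u v, a ≤ u → u < v → v ≤ b → v - u ≤ d - c → oscSq φ u v ≤ κ) :
    oscSq (decRearrangement a b φ) c d ≤ κ := by
  have hmean := fun α : ℝ => integral_comp_clamp (H := fun x => x - α) hac hcd hdb hφ
    (by fun_prop)
  have hdef := integral_comp_clamp
    (H := fun x => (decRearrangement a b φ c - x) * (x - decRearrangement a b φ d)) hac hcd hdb hφ
    (by fun_prop)
  set f := decRearrangement a b φ with hf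
  have hanti : AntitoneOn f (Ioo a b) :=
    antitoneOn_decRearrangement hφ.aestronglyMeasurable.aemeasurable
  have hc : c ∈ Ioo a b := ⟨hac, hcd.trans hdb⟩
  have hd : d ∈ Ioo a b := ⟨hac.trans hcd, hdb⟩
  have hmM : f d ≤ f c := hanti hc hd hcd.le
  have hs : 0 < d - c := sub_pos.2 hcd
  obtain ⟨hf1, hf2⟩ := integrableOn_of_memLp_two (memLp_decRearrangement hφ) hac.le hdb.le
  rw [← hf] at hf1 hf2
  have hconst : ∀ k : ℝ, ∫ _ in Ioo c d, k = k * (d - c) := fun k => by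
    rw [setIntegral_const, Real.volume_real_Ioo_of_le hcd.le, smul_eq_mul, mul_comm]
  have hkint : ∀ k : ℝ, IntegrableOn (fun _ : ℝ => k) (Ioo c d) := fun k =>
    integrableOn_const measure_Ioo_lt_top.ne
  set α := (∫ x in Ioo c d, f x) / (d - c) with hα
  have hfα : ∫ x in Ioo c d, f x = α * (d - c) := by rw [hα, div_mul_cancel₀ _ hs.ne']
  have hm : f d ≤ α := by
    rw [hα, le_div_iff₀ hs, ← hconst]
    exact setIntegral_mono_on (hkint _) hf1 measurableSet_Ioo fun x hx =>
      hanti ⟨hac.trans hx.1, hx.2.trans hdb⟩ hd hx.2.le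
  have hM : α ≤ f c := by
    rw [hα, div_le_iff₀ hs, ← hconst]
    exact setIntegral_mono_on hf1 (hkint _) measurableSet_Ioo fun x hx =>
      hanti hc ⟨hac.trans hx.1, hx.2.trans hdb⟩ hx.1.le
  set g : ℝ → ℝ := fun x => max (f d) (min x (f c)) with hg
  have hgφ : MemLp (g ∘ φ) 2 (volume.restrict (Ioo a b)) :=
    memLp_clamp_comp hmM hφ.aestronglyMeasurable
  have hrange : ∀ x, g x ∈ Icc (f d) (f c) := fun x =>
    ⟨le_max_left _ _, max_le hmM (min_le_right _ _)⟩
  set y : ℝ → ℝ := (Ioo a b).indicator fun x => g (φ x) - α with hy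
  have hyeq : ∀ x ∈ Ioo a b, y x = g (φ x) - α := fun x hx => indicator_of_mem hx _
  have hyint : Integrable y :=
    IntegrableOn.integrable_indicator ((hgφ.integrable one_le_two).sub (integrable_const α))
      measurableSet_Ioo
  have hbd : ∀ x, y x ∈ Icc (-(α - f d)) (f c - α) := by
    intro x
    by_cases hx : x ∈ Ioo a b
    · rw [hyeq x hx]
      exact ⟨by linarith [(hrange (φ x)).1], by linarith [(hrange (φ x)).2]⟩
    · rw [hy, indicator_of_notMem hx]
      exact ⟨by linarith, by linarith⟩
  have hchord : ∀ u v, a ≤ u → u < v → v ≤ b → v - u ≤ d - c → ∫ x in Ioo u v, y x = 0 →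
      ∫ x in Ioo u v, y x ^ 2 ≤ κ * (v - u) := by
    intro u v hu huv hv hlen h0
    have hsub := Ioo_subset_Ioo hu hv
    have hμ : volume.restrict (Ioo u v) ≤ volume.restrict (Ioo a b) :=
      Measure.restrict_mono hsub le_rfl
    have hle := (oscSq_comp_le huv (lipschitzWith_clamp (f d) (f c)) (hφ.mono_measure hμ)
      (hgφ.mono_measure hμ)).trans (hosc u v hu huv hv hlen)
    obtain ⟨h1, h2⟩ := integrableOn_of_memLp_two hgφ hu hv
    rw [oscSq_eq_shift huv h1 h2 α] at hle
    have hpos := sub_pos.2 huv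
    rw [setIntegral_congr_fun measurableSet_Ioo fun x hx => hyeq x (hsub hx),
      integral_sub (f := fun x => g (φ x)) h1 (integrableOn_const measure_Ioo_lt_top.ne), setIntegral_const,
      Real.volume_real_Ioo_of_le huv.le, smul_eq_mul] at h0
    have h3 : (∫ x in Ioo u v, (g ∘ φ) x) / (v - u) = α := by
      rw [div_eq_iff hpos.ne']
      simp only [Function.comp_apply]
      linarith
    rw [h3, sub_self, zero_pow two_ne_zero, sub_zero, div_le_iff₀ hpos] at hle
    rw [setIntegral_congr_fun (g := fun x => (g (φ x) - α) ^ 2) measurableSet_Ioo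
      fun x hx => by simp only [hyeq x (hsub hx)]]
    exact hle
  have key := defect_bound hyint hbd (sub_nonneg.2 hM) (sub_nonneg.2 hm) hs (sub_nonneg.2 hac.le)
    (sub_nonneg.2 hdb.le) (by ring) (a := a) (b := b) (κ := κ) ?_ hchord hκ
  · have e1 : ∫ x in Ioo a b, (f c - α - y x) * (α - f d + y x) =
        ∫ x in Ioo c d, (f c - f x) * (f x - f d) := by
      rw [setIntegral_congr_fun (g := fun x => (f c - g (φ x)) * (g (φ x) - f d))
        measurableSet_Ioo fun x hx => by simp only [hyeq x hx]; ring]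
      simpa using hdef
    have e2 : ∫ x in Ioo c d, (f c - f x) * (f x - f d) =
        (f c - α) * (α - f d) * (d - c) - ∫ x in Ioo c d, (f x - α) ^ 2 := by
      have hsq : IntegrableOn (fun x => (f x - α) ^ 2) (Ioo c d) := by
        have he : (fun x => (f x - α) ^ 2) = fun x => f x ^ 2 - 2 * α * f x + α ^ 2 := by
          ext x; ring
        rw [he]
        exact (hf2.sub (hf1.const_mul _)).add (hkint _)
      have hlin : IntegrableOn (fun x => (f c + f d - 2 * α) * (f x - α)) (Ioo c d) :=
        (hf1.sub (hkint α)).const_mul _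
      have he : (fun x => (f c - f x) * (f x - f d)) = fun x =>
          (f c - α) * (α - f d) + (f c + f d - 2 * α) * (f x - α) - (f x - α) ^ 2 := by
        ext x; ring
      rw [he, integral_sub (f := fun x => (f c - α) * (α - f d) + (f c + f d - 2 * α) * (f x - α))
        ((hkint _).add hlin) hsq, integral_add (hkint _) hlin, hconst, integral_const_mul,
        integral_sub hf1 (hkint α), hconst, hfα]
      ring
    rw [e1, e2] at key
    refine (oscSq_le_shift hcd hf1 hf2 α).trans ((div_le_iff₀ hs).2 ?_)
    linarith
  · rw [setIntegral_congr_fun measurableSet_Ioo hyeq]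
    refine (hmean α).trans ?_
    rw [integral_sub hf1 (hkint α), hconst, hfα]
    ring

/-- A bound for the oscillation of `φ` at scale `d - c` passes to its rearrangement. -/
theorem oscSq_decRearrangement_le {a b c d κ : ℝ} {φ : ℝ → ℝ} (hac : a ≤ c)
    (hcd : c < d) (hdb : d ≤ b) (hφ : MemLp φ 2 (volume.restrict (Ioo a b))) (hκ : 0 ≤ κ)
    (hosc : ∀ u v, a ≤ u → u < v → v ≤ b → v - u ≤ d - c → oscSq φ u v ≤ κ) :
    oscSq (decRearrangement a b φ) c d ≤ κ := by
  set f := decRearrangement a b φ with hf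
  obtain ⟨h1, h2⟩ := integrableOn_of_memLp_two (memLp_decRearrangement hφ) hac hdb
  rw [← hf] at h1 h2
  have hcont : ∀ w : ℝ → ℝ, IntegrableOn w (Ioo c d) → Filter.Tendsto
      (fun t => ∫ x in Ioo (c + t) (d - t), w x) (nhdsWithin 0 (Ioi 0))
      (nhds (∫ x in Ioo c d, w x)) := by
    intro w hw
    have hi : Integrable ((Ioo c d).indicator w) := hw.integrable_indicator measurableSet_Ioo
    have hF := hi.continuous_primitive c
    have hlim : Filter.Tendsto (fun t => (∫ x in c..(d - t), (Ioo c d).indicator w x) -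
        ∫ x in c..(c + t), (Ioo c d).indicator w x) (nhdsWithin 0 (Ioi 0))
        (nhds (∫ x in Ioo c d, w x)) := by
      have hct : Continuous fun t : ℝ => (∫ x in c..(d - t), (Ioo c d).indicator w x) -
        ∫ x in c..(c + t), (Ioo c d).indicator w x :=
        (hF.comp (continuous_const.sub continuous_id)).sub
          (hF.comp (continuous_const.add continuous_id))
      have := (hct.tendsto 0).mono_left (nhdsWithin_le_nhds (s := Ioi 0))
      rw [← integral_Ioo_eq_sub hi c (by linarith), sub_zero, add_zero,
        setIntegral_congr_fun measurableSet_Ioo fun x hx => indicator_of_mem hx w] at this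
      exact this
    refine hlim.congr' ?_
    have hev : ∀ᶠ t : ℝ in nhdsWithin 0 (Ioi 0), t ∈ Ioo 0 ((d - c) / 2) :=
      Ioo_mem_nhdsGT (by linarith)
    filter_upwards [hev] with t ht
    rw [← integral_Ioo_eq_sub hi c (by linarith [ht.2])]
    refine setIntegral_congr_fun measurableSet_Ioo fun x hx => indicator_of_mem ?_ w
    exact ⟨by linarith [hx.1, ht.1], by linarith [hx.2, ht.1]⟩
  have hlen : Filter.Tendsto (fun t : ℝ => (d - t) - (c + t)) (nhdsWithin 0 (Ioi 0))
      (nhds (d - c)) := by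
    have : Continuous fun t : ℝ => (d - t) - (c + t) := by fun_prop
    simpa using (this.tendsto 0).mono_left (nhdsWithin_le_nhds (s := Ioi 0))
  have hne : d - c ≠ 0 := by linarith
  have hlim := ((hcont _ h2).div hlen hne).sub (((hcont _ h1).div hlen hne).pow 2)
  rw [oscSq_eq f hcd]
  refine le_of_tendsto hlim ?_
  have hev : ∀ᶠ t : ℝ in nhdsWithin 0 (Ioi 0), t ∈ Ioo 0 ((d - c) / 2) :=
    Ioo_mem_nhdsGT (by linarith)
  filter_upwards [hev] with t ht
  have hlt : c + t < d - t := by linarith [ht.2]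
  have := oscSq_decRearrangement_le_of_interior (c := c + t) (d := d - t) (by linarith [ht.1]) hlt
    (by linarith [ht.1]) hφ hκ fun u v h1 h2 h3 h4 => hosc u v h1 h2 h3 (by linarith [ht.1])
  rw [oscSq_eq _ hlt] at this
  exact this

noncomputable section

/-- The quadratic oscillation `|J| ∫_J f² - (∫_J f)²`, that is `|J|²` times `oscSq`. -/
def scaledOsc (f : ℝ → ℝ) (c d : ℝ) : ℝ :=
  (d - c) * (∫ x in c..d, f x ^ 2) - (∫ x in c..d, f x) ^ 2

theorem scaledOsc_eq_mul_oscSq (f : ℝ → ℝ) {c d : ℝ} (hcd : c < d) :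
    scaledOsc f c d = (d - c) ^ 2 * oscSq f c d := by
  have : d - c ≠ 0 := by linarith
  rw [oscSq_eq f hcd, scaledOsc, intervalIntegral.integral_of_le hcd.le,
    intervalIntegral.integral_of_le hcd.le, integral_Ioc_eq_integral_Ioo,
    integral_Ioc_eq_integral_Ioo]
  field_simp

theorem intervalIntegrable_sub_const_sq {f : ℝ → ℝ} {c d : ℝ} (h1 : IntervalIntegrable f volume c d)
    (h2 : IntervalIntegrable (fun x => f x ^ 2) volume c d) (k : ℝ) :
    IntervalIntegrable (fun x => (f x - k) ^ 2) volume c d := by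
  have he : (fun x => (f x - k) ^ 2) = fun x => f x ^ 2 - 2 * k * f x + k ^ 2 := by
    ext x; ring
  rw [he]
  exact (h2.sub (h1.const_mul _)).add intervalIntegrable_const

theorem scaledOsc_sub_const {f : ℝ → ℝ} {c d : ℝ} (h1 : IntervalIntegrable f volume c d)
    (h2 : IntervalIntegrable (fun x => f x ^ 2) volume c d) (k : ℝ) :
    scaledOsc f c d = scaledOsc (fun x => f x - k) c d := by
  have he : (fun x => (f x - k) ^ 2) = fun x => f x ^ 2 - 2 * k * f x + k ^ 2 := by
    ext x; ring
  have hl : IntervalIntegrable (fun x => f x ^ 2 - 2 * k * f x) volume c d :=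
    h2.sub (h1.const_mul _)
  simp only [scaledOsc]
  rw [he, intervalIntegral.integral_add hl intervalIntegrable_const,
    intervalIntegral.integral_sub h2 (h1.const_mul _), intervalIntegral.integral_const_mul,
    intervalIntegral.integral_sub h1 intervalIntegrable_const,
    intervalIntegral.integral_const, intervalIntegral.integral_const, smul_eq_mul, smul_eq_mul]
  ring

theorem sq_integral_le {w : ℝ → ℝ} {c d : ℝ} (hcd : c ≤ d) (h1 : IntervalIntegrable w volume c d)
    (h2 : IntervalIntegrable (fun x => w x ^ 2) volume c d) :
    (∫ x in c..d, w x) ^ 2 ≤ (d - c) * ∫ x in c..d, w x ^ 2 := by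
  rcases hcd.eq_or_lt with rfl | hlt
  · simp
  have := scaledOsc_eq_mul_oscSq w hlt
  rw [intervalIntegrable_iff_integrableOn_Ioo_of_le hcd] at h1 h2
  have h0 := mul_nonneg (sq_nonneg (d - c)) (oscSq_nonneg hlt h1 h2)
  rw [← this, scaledOsc] at h0
  linarith

theorem IntervalIntegrable.mono_of_le {f : ℝ → ℝ} {a b c d : ℝ}
    (h : IntervalIntegrable f volume a b) (hac : a ≤ c) (hcd : c ≤ d) (hdb : d ≤ b) :
    IntervalIntegrable f volume c d :=
  h.mono_set (by
    rw [uIcc_of_le hcd, uIcc_of_le (hac.trans (hcd.trans hdb))]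
    exact Icc_subset_Icc hac hdb)

/-- For antitone `f`, the oscillation has a supporting line as a function of the right end. -/
theorem scaledOsc_right_support {f : ℝ → ℝ} {a b c d d' : ℝ}
    (h1 : IntervalIntegrable f volume a b)
    (h2 : IntervalIntegrable (fun x => f x ^ 2) volume a b) (hanti : AntitoneOn f (Ioo a b))
    (hac : a ≤ c) (hcd : c ≤ d) (had : a < d) (hdb : d < b) (hcd' : c ≤ d') (hdb' : d' ≤ b) :
    scaledOsc f c d + (d' - d) * (∫ x in c..d, (f x - f d) ^ 2) ≤ scaledOsc f c d' := by
  set k := f d with hk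
  have hd : d ∈ Ioo a b := ⟨had, hdb⟩
  have i1 : ∀ u v, a ≤ u → u ≤ v → v ≤ b → IntervalIntegrable f volume u v :=
    fun u v e1 e2 e3 => IntervalIntegrable.mono_of_le h1 e1 e2 e3
  have i2 : ∀ u v, a ≤ u → u ≤ v → v ≤ b → IntervalIntegrable (fun x => f x ^ 2) volume u v :=
    fun u v e1 e2 e3 => IntervalIntegrable.mono_of_le h2 e1 e2 e3
  have j1 : ∀ u v, a ≤ u → u ≤ v → v ≤ b → IntervalIntegrable (fun x => f x - k) volume u v :=
    fun u v e1 e2 e3 => (i1 u v e1 e2 e3).sub intervalIntegrable_const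
  have j2 : ∀ u v, a ≤ u → u ≤ v → v ≤ b →
      IntervalIntegrable (fun x => (f x - k) ^ 2) volume u v :=
    fun u v e1 e2 e3 => intervalIntegrable_sub_const_sq (i1 u v e1 e2 e3) (i2 u v e1 e2 e3) k
  rw [scaledOsc_sub_const (i1 c d hac hcd hdb.le) (i2 c d hac hcd hdb.le) k,
    scaledOsc_sub_const (i1 c d' hac hcd' hdb') (i2 c d' hac hcd' hdb') k]
  simp only [scaledOsc]
  rcases le_total d d' with hdd | hdd
  · have had' := hac.trans hcd
    rw [← intervalIntegral.integral_add_adjacent_intervals (j1 c d hac hcd hdb.le)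
        (j1 d d' had' hdd hdb'),
      ← intervalIntegral.integral_add_adjacent_intervals (j2 c d hac hcd hdb.le)
        (j2 d d' had' hdd hdb')]
    have hS : 0 ≤ ∫ x in c..d, (f x - k) := by
      rw [intervalIntegral.integral_of_le hcd, integral_Ioc_eq_integral_Ioo]
      exact setIntegral_nonneg measurableSet_Ioo fun x hx =>
        sub_nonneg.2 (hanti ⟨hac.trans_lt hx.1, hx.2.trans hdb⟩ hd hx.2.le)
    have hS' : ∫ x in d..d', (f x - k) ≤ 0 := by
      rw [intervalIntegral.integral_of_le hdd, integral_Ioc_eq_integral_Ioo]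
      exact setIntegral_nonpos measurableSet_Ioo fun x hx =>
        sub_nonpos.2 (hanti hd ⟨had.trans hx.1, hx.2.trans_le hdb'⟩ hx.1.le)
    have hq' : 0 ≤ ∫ x in d..d', (f x - k) ^ 2 :=
      intervalIntegral.integral_nonneg hdd fun x _ => sq_nonneg _
    have hCS := sq_integral_le hdd (j1 d d' had' hdd hdb') (j2 d d' had' hdd hdb')
    nlinarith [mul_nonneg hS (neg_nonneg.2 hS'), mul_nonneg (sub_nonneg.2 hcd) hq']
  · have had' := hac.trans hcd'
    rw [← intervalIntegral.integral_add_adjacent_intervals (j1 c d' hac hcd' hdb')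
        (j1 d' d had' hdd hdb.le),
      ← intervalIntegral.integral_add_adjacent_intervals (j2 c d' hac hcd' hdb')
        (j2 d' d had' hdd hdb.le)]
    have hS' : 0 ≤ ∫ x in d'..d, (f x - k) := by
      rw [intervalIntegral.integral_of_le hdd, integral_Ioc_eq_integral_Ioo]
      exact setIntegral_nonneg measurableSet_Ioo fun x hx =>
        sub_nonneg.2 (hanti ⟨had'.trans_lt hx.1, hx.2.trans hdb⟩ hd hx.2.le)
    have hcross : (d' - c) * (∫ x in d'..d, (f x - k) ^ 2) ≤
        (∫ x in c..d', (f x - k)) * ∫ x in d'..d, (f x - k) := by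
      rcases hcd'.eq_or_lt with rfl | hlt
      · simp
      have hd' : d' ∈ Ioo a b := ⟨hac.trans_lt hlt, hdd.trans_lt hdb⟩
      have hμ : 0 ≤ f d' - k := sub_nonneg.2 (hanti hd' hd hdd)
      have e1 : (d' - c) * (f d' - k) ≤ ∫ x in c..d', (f x - k) := by
        rw [← smul_eq_mul, ← intervalIntegral.integral_const]
        refine intervalIntegral.integral_mono_on_of_le_Ioo hcd' intervalIntegrable_const
          (j1 c d' hac hcd' hdb') fun x hx => ?_
        exact sub_le_sub_right (hanti ⟨hac.trans_lt hx.1, hx.2.trans hd'.2⟩ hd' hx.2.le) _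
      have e2 : ∫ x in d'..d, (f x - k) ^ 2 ≤ (f d' - k) * ∫ x in d'..d, (f x - k) := by
        rw [← intervalIntegral.integral_const_mul]
        refine intervalIntegral.integral_mono_on_of_le_Ioo hdd (j2 d' d had' hdd hdb.le)
          ((j1 d' d had' hdd hdb.le).const_mul _) fun x hx => ?_
        have hx' : x ∈ Ioo a b := ⟨had'.trans_lt hx.1, hx.2.trans hdb⟩
        have f1 := hanti hx' hd hx.2.le
        have f2 := hanti hd' hx' hx.1.le
        nlinarith
      calc _ ≤ (d' - c) * ((f d' - k) * ∫ x in d'..d, (f x - k)) :=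
            mul_le_mul_of_nonneg_left e2 (sub_nonneg.2 hcd')
        _ = (d' - c) * (f d' - k) * ∫ x in d'..d, (f x - k) := by ring
        _ ≤ _ := mul_le_mul_of_nonneg_right e1 hS'
    nlinarith [mul_nonneg (sub_nonneg.2 hcd') hS', sq_nonneg (∫ x in d'..d, (f x - k)),
      intervalIntegral.integral_nonneg hdd (f := fun x => (f x - k) ^ 2)
        (fun x _ => sq_nonneg _) (μ := volume)]

theorem scaledOsc_reflect (f : ℝ → ℝ) (c d : ℝ) :
    scaledOsc (fun x => - f (-x)) (-d) (-c) = scaledOsc f c d := by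
  have e1 := intervalIntegral.integral_comp_neg (a := -d) (b := -c) (fun x => f x ^ 2)
  have e2 := intervalIntegral.integral_comp_neg (a := -d) (b := -c) f
  simp only [neg_neg] at e1 e2
  simp only [scaledOsc, neg_sq, intervalIntegral.integral_neg]
  rw [e1, e2]
  ring

theorem scaledOsc_left_support {f : ℝ → ℝ} {a b c d c' : ℝ}
    (h1 : IntervalIntegrable f volume a b)
    (h2 : IntervalIntegrable (fun x => f x ^ 2) volume a b) (hanti : AntitoneOn f (Ioo a b))
    (hac : a < c) (hcb : c < b) (hcd : c ≤ d) (hdb : d ≤ b) (hac' : a ≤ c') (hcd' : c' ≤ d) :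
    scaledOsc f c d + (c - c') * (∫ x in c..d, (f x - f c) ^ 2) ≤ scaledOsc f c' d := by
  have k1 : IntervalIntegrable (fun x => - f (-x)) volume (-b) (-a) :=
    ((IntervalIntegrable.iff_comp_neg (by simp)).1 h1.symm).neg
  have k2 : IntervalIntegrable (fun x => (- f (-x)) ^ 2) volume (-b) (-a) := by
    simpa only [neg_sq] using (IntervalIntegrable.iff_comp_neg (by simp)).1 h2.symm
  have := scaledOsc_right_support (c := -d) (d := -c) (d' := -c') k1 k2
    (fun x hx z hz hxz => neg_le_neg (hanti ⟨by linarith [hz.2], by linarith [hz.1]⟩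
      ⟨by linarith [hx.2], by linarith [hx.1]⟩ (neg_le_neg hxz)))
    (by linarith) (by linarith) (by linarith) (by linarith) (by linarith) (by linarith)
  rw [scaledOsc_reflect, scaledOsc_reflect] at this
  have e1 := intervalIntegral.integral_comp_neg (a := -d) (b := -c) (fun x => (f x - f c) ^ 2)
  simp only [neg_neg] at e1 this
  rw [← e1]
  have e2 : ∀ x, (-f (-x) - -f c) ^ 2 = (f (-x) - f c) ^ 2 := fun x => by ring
  simp only [e2] at this
  linarith

/-- For antitone `f`, the oscillation is convex along affine families of nested intervals. -/
theorem scaledOsc_le_of_nested {f : ℝ → ℝ} {a b c d c₁ d₁ c₂ d₂ p q : ℝ}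
    (h1 : IntervalIntegrable f volume a b)
    (h2 : IntervalIntegrable (fun x => f x ^ 2) volume a b) (hanti : AntitoneOn f (Ioo a b))
    (ha : a ≤ c₂) (hc2 : c₂ ≤ c) (hc1 : c ≤ c₁) (hcd1 : c₁ ≤ d₁) (hd1 : d₁ ≤ d) (hd2 : d ≤ d₂)
    (hb : d₂ ≤ b) (hcd : c < d) (hp : 0 < p) (hq : 0 ≤ q) (hpq : p + q = 1)
    (hc : c = p * c₁ + q * c₂) (hd : d = p * d₁ + q * d₂) :
    scaledOsc f c d ≤ p * scaledOsc f c₁ d₁ + q * scaledOsc f c₂ d₂ := by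
  have hq' : q = 1 - p := by linarith
  obtain ⟨A, hA2, hA1⟩ : ∃ A, scaledOsc f c d + (d₂ - d) * A ≤ scaledOsc f c d₂ ∧
      scaledOsc f c d + (d₁ - d) * A ≤ scaledOsc f c d₁ := by
    rcases (hd2.trans hb).eq_or_lt with h | h
    · have e2 : d₂ = d := le_antisymm (hb.trans h.ge) hd2
      have e1 : d₁ = d := by
        have : p * (d - d₁) = 0 := by rw [e2, hq'] at hd; linarith
        rcases mul_eq_zero.1 this with h | h <;> linarith
      exact ⟨0, by rw [e2]; simp, by rw [e1]; simp⟩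
    · exact ⟨_, scaledOsc_right_support h1 h2 hanti (ha.trans hc2) hcd.le (by linarith) h
        (by linarith) hb, scaledOsc_right_support h1 h2 hanti (ha.trans hc2) hcd.le (by linarith) h
        (hc1.trans hcd1) (by linarith)⟩
  obtain ⟨B, hB2, hB1⟩ : ∃ B, scaledOsc f c d₂ + (c - c₂) * B ≤ scaledOsc f c₂ d₂ ∧
      scaledOsc f c d₁ + (c - c₁) * B ≤ scaledOsc f c₁ d₁ := by
    rcases (ha.trans hc2).eq_or_lt with h | h
    · have e2 : c₂ = c := le_antisymm hc2 (h.ge.trans ha)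
      have e1 : c₁ = c := by
        have : p * (c - c₁) = 0 := by rw [e2, hq'] at hc; linarith
        rcases mul_eq_zero.1 this with h | h <;> linarith
      exact ⟨0, by rw [e2]; simp, by rw [e1]; simp⟩
    · have hcb : c < b := by linarith
      have s2 := scaledOsc_left_support (c := c) (d := d₂) (c' := c₂) h1 h2 hanti h hcb
        (by linarith) hb ha (by linarith)
      have s1 := scaledOsc_left_support (c := c) (d := d₁) (c' := c₁) h1 h2 hanti h hcb
        (by linarith) (by linarith) (by linarith) hcd1
      have mono : ∀ u v, c ≤ u → u ≤ v → v ≤ b →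
          ∫ x in c..u, (f x - f c) ^ 2 ≤ ∫ x in c..v, (f x - f c) ^ 2 := by
        intro u v e1 e2 e3
        have hi : IntervalIntegrable (fun x => (f x - f c) ^ 2) volume c v :=
          intervalIntegrable_sub_const_sq (IntervalIntegrable.mono_of_le h1 h.le (e1.trans e2) e3)
            (IntervalIntegrable.mono_of_le h2 h.le (e1.trans e2) e3) _
        exact intervalIntegral.integral_mono_interval le_rfl e1 e2
          (Filter.Eventually.of_forall fun x => sq_nonneg _) hi
      have m2 := mono d d₂ hcd.le hd2 hb
      have m1 := mono d₁ d (by linarith) hd1 (by linarith)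
      refine ⟨∫ x in c..d, (f x - f c) ^ 2, ?_, ?_⟩
      · nlinarith
      · nlinarith
  have t1 := mul_le_mul_of_nonneg_left hA1 hp.le
  have t2 := mul_le_mul_of_nonneg_left hA2 hq
  have t3 := mul_le_mul_of_nonneg_left hB1 hp.le
  have t4 := mul_le_mul_of_nonneg_left hB2 hq
  have u1 : p * ((d₁ - d) * A) + q * ((d₂ - d) * A) = 0 := by
    have : p * (d₁ - d) + q * (d₂ - d) = 0 := by
      rw [hq'] at hd ⊢; linarith
    linear_combination A * this
  have u2 : p * ((c - c₁) * B) + q * ((c - c₂) * B) = 0 := by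
    have : p * (c - c₁) + q * (c - c₂) = 0 := by
      rw [hq'] at hc ⊢; linarith
    linear_combination B * this
  have u3 : scaledOsc f c d = p * scaledOsc f c d + q * scaledOsc f c d := by
    rw [← add_mul, hpq, one_mul]
  linarith

theorem IsVMO.exists_oscSq_le {a b : ℝ} {φ : ℝ → ℝ} (hφ : IsVMO a b φ) :
    ∃ C, ∀ c d, a ≤ c → c < d → d ≤ b → oscSq φ c d ≤ C := by
  obtain ⟨δ, hδ, h⟩ := hφ.2 1 one_pos
  have hint := hφ.1.integrable_sq
  refine ⟨max 1 ((∫ x in Ioo a b, φ x ^ 2) / δ), fun c d hac hcd hdb => ?_⟩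
  rcases le_total (d - c) δ with hle | hle
  · exact (h c d hac hcd hdb hle).trans (le_max_left _ _)
  · refine le_trans ?_ (le_max_right _ _)
    have h0 : ∫ x in Ioo c d, φ x ^ 2 ≤ ∫ x in Ioo a b, φ x ^ 2 :=
      setIntegral_mono_set hint (Filter.Eventually.of_forall fun x => sq_nonneg _)
        (Ioo_subset_Ioo hac hdb).eventuallyLE
    rw [oscSq_eq φ hcd]
    have h1 : (∫ x in Ioo c d, φ x ^ 2) / (d - c) ≤ (∫ x in Ioo a b, φ x ^ 2) / δ :=
      div_le_div₀ (integral_nonneg fun x => sq_nonneg _) h0 hδ hle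
    linarith [sq_nonneg ((∫ x in Ioo c d, φ x) / (d - c))]

theorem vmoModulus_nonneg (a b : ℝ) (φ : ℝ → ℝ) (t : ℝ) : 0 ≤ vmoModulus a b φ t := by
  unfold vmoModulus
  split_ifs
  · refine Real.sSup_nonneg ?_
    rintro _ ⟨c, d, -, -, -, -, rfl⟩
    exact Real.sqrt_nonneg _
  · exact le_rfl

theorem IsVMO.oscSq_le_vmoModulus_sq {a b c d t : ℝ} {φ : ℝ → ℝ} (hφ : IsVMO a b φ) (hac : a ≤ c)
    (hcd : c < d) (hdb : d ≤ b) (ht : d - c ≤ t) : oscSq φ c d ≤ vmoModulus a b φ t ^ 2 := by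
  have ht0 : 0 < t := by linarith
  obtain ⟨C, hC⟩ := hφ.exists_oscSq_le
  refine (Real.sqrt_le_iff.1 (?_ : √(oscSq φ c d) ≤ vmoModulus a b φ t)).2
  rw [vmoModulus, if_pos ht0]
  refine le_csSup ⟨√C, ?_⟩ ⟨c, d, hac, hcd, hdb, ht, rfl⟩
  rintro _ ⟨u, v, h1, h2, h3, -, rfl⟩
  exact Real.sqrt_le_sqrt (hC u v h1 h2 h3)

theorem vmoModulus_le {a b t M : ℝ} {φ : ℝ → ℝ} (hM : 0 ≤ M)
    (h : ∀ c d, a ≤ c → c < d → d ≤ b → d - c ≤ t → oscSq φ c d ≤ M ^ 2) :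
    vmoModulus a b φ t ≤ M := by
  unfold vmoModulus
  split_ifs
  · refine Real.sSup_le ?_ hM
    rintro _ ⟨c, d, h1, h2, h3, h4, rfl⟩
    exact Real.sqrt_le_iff.2 ⟨hM, h c d h1 h2 h3 h4⟩
  · exact hM

/-- An interval of length strictly between `x` and `y` lies on an affine family of nested intervals
from one of length `x` to one of length `y`. -/
theorem exists_nested_intervals {a b c d x y p q : ℝ} (hac : a ≤ c) (hdb : d ≤ b)
    (hy : d - c ≤ y) (hyb : y ≤ b - a) (hp : 0 < p) (hq : 0 ≤ q) (hpq : p + q = 1)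
    (hlen : d - c = p * x + q * y) :
    ∃ c₁ c₂, a ≤ c₂ ∧ c₂ ≤ c ∧ c ≤ c₁ ∧ c₁ + x ≤ d ∧ d ≤ c₂ + y ∧ c₂ + y ≤ b ∧
      c = p * c₁ + q * c₂ ∧ d = p * (c₁ + x) + q * (c₂ + y) := by
  have hp' : p = 1 - q := by linarith
  obtain ⟨c₂, h1, h2, h3, h4⟩ : ∃ c₂, a ≤ c₂ ∧ c₂ ≤ c ∧ d ≤ c₂ + y ∧ c₂ + y ≤ b := by
    rcases le_total (y - (d - c)) (c - a) with h | h
    · exact ⟨d - y, by linarith, by linarith, by linarith, by linarith⟩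
    · exact ⟨a, le_rfl, hac, by linarith, by linarith⟩
  have hc₁ : c = p * ((c - q * c₂) / p) + q * c₂ := by
    rw [mul_div_cancel₀ _ hp.ne']; ring
  have hd : d = p * ((c - q * c₂) / p + x) + q * (c₂ + y) := by linarith
  have e1 := mul_nonneg hq (sub_nonneg.2 h2)
  have e2 := mul_nonneg hq (sub_nonneg.2 h3)
  refine ⟨(c - q * c₂) / p, c₂, h1, h2, ?_, ?_, h3, h4, hc₁, hd⟩
  · rw [le_div_iff₀ hp, hp']
    linarith
  · refine le_of_mul_le_mul_left ?_ hp
    have : p * d = d - q * d := by rw [hp']; ring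
    linarith

/-- If `r² o` lies below the chord through `(x, X)` and `(y, Y)` at `r`, and `y² o ≤ Y`, then `z² o`
lies below the chord for `z` between `r` and `y`. -/
theorem sq_mul_le_chord {x y r z o p q p' q' X Y : ℝ} (hry : r < y) (hrz : r ≤ z) (hzy : z ≤ y)
    (hxy : x < y) (ho : 0 ≤ o) (hpq : p + q = 1) (hpq' : p' + q' = 1) (hz : z = p * x + q * y)
    (hr : r = p' * x + q' * y) (hro : r ^ 2 * o ≤ p' * X + q' * Y) (hyo : y ^ 2 * o ≤ Y) :
    z ^ 2 * o ≤ p * X + q * Y := by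
  have hyr : 0 < y - r := sub_pos.2 hry
  obtain ⟨θ, hθ⟩ : ∃ θ, θ = (y - z) / (y - r) := ⟨_, rfl⟩
  have hθ0 : 0 ≤ θ := hθ ▸ div_nonneg (by linarith) hyr.le
  have hθ1 : 0 ≤ 1 - θ := by
    have : θ ≤ 1 := hθ ▸ (div_le_one hyr).2 (by linarith)
    linarith
  have hmul : θ * (y - r) = y - z := by rw [hθ, div_mul_cancel₀ _ hyr.ne']
  have hpθ : p = θ * p' := by
    have h1 : y - z = p * (y - x) := by rw [hz]; linear_combination (-y) * hpq
    have h2 : y - r = p' * (y - x) := by rw [hr]; linear_combination (-y) * hpq'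
    rw [h1, h2, ← mul_assoc] at hmul
    exact (mul_right_cancel₀ (sub_pos.2 hxy).ne' hmul).symm
  have hqθ : q = θ * q' + (1 - θ) := by
    have : q' = 1 - p' := by linarith
    rw [this]
    linarith
  have hsq : z ^ 2 ≤ θ * r ^ 2 + (1 - θ) * y ^ 2 := by
    have hzθ : z = θ * r + (1 - θ) * y := by linarith
    rw [hzθ]
    linarith [mul_nonneg (mul_nonneg hθ0 hθ1) (sq_nonneg (r - y))]
  have e1 := mul_le_mul_of_nonneg_right hsq ho
  have e2 := mul_le_mul_of_nonneg_left hro hθ0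
  have e3 := mul_le_mul_of_nonneg_left hyo hθ1
  rw [hpθ, hqθ]
  linarith

theorem convexOn_sq_mul_vmoModulus_sq {a b : ℝ} {f : ℝ → ℝ} (hf : IsVMO a b f)
    (hanti : AntitoneOn f (Ioo a b)) :
    ConvexOn ℝ (Icc 0 (b - a)) fun t => t ^ 2 * vmoModulus a b f t ^ 2 := by
  refine LinearOrder.convexOn_of_lt (convex_Icc _ _) fun x hx y hy hxy p q hp hq hpq => ?_
  simp only [smul_eq_mul]
  set X := x ^ 2 * vmoModulus a b f x ^ 2 with hX
  set Y := y ^ 2 * vmoModulus a b f y ^ 2 with hY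
  set z := p * x + q * y with hz
  have hX0 : 0 ≤ X := by positivity
  have hY0 : 0 ≤ Y := by positivity
  have hR : 0 ≤ p * X + q * Y := by positivity
  have hq' : q = 1 - p := by linarith
  have hxz : x < z := by rw [hz, hq']; nlinarith
  have hzy : z < y := by rw [hz, hq']; nlinarith
  have hz0 : 0 < z := hx.1.trans_lt hxz
  have hab : a ≤ b := by linarith [hx.1, hx.2]
  have hb1 : IntervalIntegrable f volume a b := by
    rw [intervalIntegrable_iff_integrableOn_Ioo_of_le hab]
    exact (integrableOn_of_memLp_two hf.1 le_rfl le_rfl).1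
  have hb2 : IntervalIntegrable (fun x => f x ^ 2) volume a b := by
    rw [intervalIntegrable_iff_integrableOn_Ioo_of_le hab]
    exact (integrableOn_of_memLp_two hf.1 le_rfl le_rfl).2
  have key : vmoModulus a b f z ≤ √(p * X + q * Y) / z := by
    refine vmoModulus_le (by positivity) fun c d hac hcd hdb hle => ?_
    rw [div_pow, Real.sq_sqrt hR, le_div_iff₀ (by positivity)]
    set o := oscSq f c d with ho
    have hr0 : 0 < d - c := sub_pos.2 hcd
    have ho0 : 0 ≤ o := by
      obtain ⟨i1, i2⟩ := integrableOn_of_memLp_two hf.1 hac hdb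
      exact oscSq_nonneg hcd i1 i2
    have hyo : y ^ 2 * o ≤ Y := mul_le_mul_of_nonneg_left
      (hf.oscSq_le_vmoModulus_sq hac hcd hdb (by linarith)) (sq_nonneg _)
    rcases le_or_gt (d - c) x with hrx | hrx
    · have hxo : x ^ 2 * o ≤ X := mul_le_mul_of_nonneg_left
        (hf.oscSq_le_vmoModulus_sq hac hcd hdb hrx) (sq_nonneg _)
      have hsq : z ^ 2 ≤ p * x ^ 2 + q * y ^ 2 := by
        rw [hz, hq']
        nlinarith [mul_nonneg (mul_nonneg hp.le hq.le) (sq_nonneg (x - y))]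
      nlinarith [mul_le_mul_of_nonneg_right hsq ho0, mul_le_mul_of_nonneg_left hxo hp.le,
        mul_le_mul_of_nonneg_left hyo hq.le]
    · have hyx : 0 < y - x := sub_pos.2 hxy
      have hry : d - c < y := by linarith
      obtain ⟨p', q', hp'0, hq'0, hpq', hrpq⟩ : ∃ p' q', 0 < p' ∧ 0 ≤ q' ∧ p' + q' = 1 ∧
          d - c = p' * x + q' * y := by
        refine ⟨(y - (d - c)) / (y - x), (d - c - x) / (y - x), div_pos (by linarith) hyx,
          div_nonneg (by linarith) hyx.le, ?_, ?_⟩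
        · field_simp
          ring
        · field_simp
          ring
      obtain ⟨c₁, c₂, n1, n2, n3, n4, n5, n6, n7, n8⟩ :=
        exists_nested_intervals hac hdb hry.le hy.2 hp'0 hq'0 hpq' hrpq
      have hV := scaledOsc_le_of_nested hb1 hb2 hanti n1 n2 n3 (by linarith [hx.1]) n4 n5 n6 hcd
        hp'0 hq'0 hpq' n7 n8
      have hV2 : scaledOsc f c₂ (c₂ + y) ≤ Y := by
        rw [scaledOsc_eq_mul_oscSq f (by linarith), add_sub_cancel_left]
        exact mul_le_mul_of_nonneg_left (hf.oscSq_le_vmoModulus_sq n1 (by linarith)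
          n6 (by linarith)) (sq_nonneg _)
      have hV1 : scaledOsc f c₁ (c₁ + x) ≤ X := by
        rcases hx.1.eq_or_lt with h | h
        · rw [← h, add_zero]
          simpa [scaledOsc] using hX0
        · rw [scaledOsc_eq_mul_oscSq f (by linarith), add_sub_cancel_left]
          exact mul_le_mul_of_nonneg_left (hf.oscSq_le_vmoModulus_sq (by linarith) (by linarith)
            (by linarith) (by linarith)) (sq_nonneg _)
      rw [scaledOsc_eq_mul_oscSq f hcd, ← ho] at hV
      have hro : (d - c) ^ 2 * o ≤ p' * X + q' * Y := by
        linarith [mul_le_mul_of_nonneg_left hV1 hp'0.le, mul_le_mul_of_nonneg_left hV2 hq'0]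
      rw [mul_comm]
      exact sq_mul_le_chord hry hle hzy.le hxy ho0 hpq hpq' hz hrpq hro hyo
  have hle := pow_le_pow_left₀ (vmoModulus_nonneg a b f z) key 2
  rw [div_pow, Real.sq_sqrt hR, le_div_iff₀ (by positivity)] at hle
  linarith

theorem IsVMO.decRearrangement {a b : ℝ} {φ : ℝ → ℝ} (hφ : IsVMO a b φ) :
    IsVMO a b (decRearrangement a b φ) := by
  refine ⟨memLp_decRearrangement hφ.1, fun ε hε => ?_⟩
  obtain ⟨δ, hδ, h⟩ := hφ.2 ε hε
  exact ⟨δ, hδ, fun c d hac hcd hdb hle => oscSq_decRearrangement_le hac hcd hdb hφ.1 hε.le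
    fun u v h1 h2 h3 h4 => h u v h1 h2 h3 (h4.trans hle)⟩

theorem vmoModulus_decRearrangement_le {a b : ℝ} {φ : ℝ → ℝ} (hφ : IsVMO a b φ) (t : ℝ) :
    vmoModulus a b (_root_.decRearrangement a b φ) t ≤ vmoModulus a b φ t :=
  vmoModulus_le (vmoModulus_nonneg a b φ t) fun _ _ hac hcd hdb hle =>
    oscSq_decRearrangement_le hac hcd hdb hφ.1 (sq_nonneg _) fun _ _ h1 h2 h3 h4 =>
      hφ.oscSq_le_vmoModulus_sq h1 h2 h3 (h4.trans hle)

end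

theorem theorem1p4 (a b : ℝ) (hab : a < b) (φ : ℝ → ℝ) (hφ : IsVMO a b φ) :
    IsVMO a b (decRearrangement a b φ) ∧
      ∀ t ∈ Icc 0 (b - a),
        vmoModulus a b (decRearrangement a b φ) t ≤
          convEnvelope (b - a) (vmoModulus a b φ) t :=
  ⟨hφ.decRearrangement, fun _ ht => le_convEnvelope
    ⟨fun s _ => vmoModulus_nonneg a b _ s, fun s _ => vmoModulus_decRearrangement_le hφ s,
      convexOn_sq_mul_vmoModulus_sq hφ.decRearrangement
        (antitoneOn_decRearrangement hφ.1.aestronglyMeasurable.aemeasurable)⟩ ht⟩
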